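/- Let $q>1$ be real. Let $\widetilde{\mathbb C}^*$ be the Riemann surface of the logarithm, and for $d\in\mathbb R$, $\varepsilon>0$ put $V_\varepsilon^d=\{\xi\in\widetilde{\mathbb C}^*:|\arg\xi-d|<\varepsilon\}$. For $k\in\mathbb Q_{>0}$ put $p=q^{1/k}$ and define: (i) the formal $q$-Borel transform of order $k$, $\hat{\mathcal B}_{q;k}\big(\sum_n c_nx^n\big)=\sum_n c_n\,p^{-n(n-1)/2}\xi^n$; (ii) the space $\mathbb E^d_{q;k}$ of functions $\varphi$ analytic in some $V^d_\varepsilon$ for which there are $A,R>0$ such that $|\varphi(\xi)|$ is bounded on $V_\varepsilon^d\cap\{|\xi|\le R\}$ and $|\varphi(\xi)|\,e^{-(\log|A\xi|)^2/(2\log p)}$ is bounded on $V_\varepsilon^d\cap\{|\xi|>R\}$; (iii) for $\varphi\in\mathbb E^d_{q;k}$, the $q$-Laplace transform $$\mathcal L^d_{q;k}\varphi(x)=\frac1{\sqrt{2\pi\log p}}\int_0^{\infty e^{\mathrm i d}}e^{-\left(\log\frac{x}{\sqrt p\,\xi}\right)^2/(2\log p)}\,\varphi(\xi)\,\frac{d\xi}{\xi},$$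 which converges for $x\in\widetilde{\mathbb C}^*$ with $|x|$ small. Let $\vec s=(s_1,\dots,s_r)$, $r\ge1$, be a strictly increasing sequence of positive rationals, and put $\tilde s_i=\big(\tfrac1{s_i}-\tfrac1{s_{i+1}}\big)^{-1}$ with $\tfrac1{s_{r+1}}=0$. A series $f\in\mathbb C[[x]]$ is $q$-multisummable of order $\vec s$ in the direction $d$ if $\hat{\mathcal B}_{q;s_1}(f)$ has a positive radius of convergence and its sum continues analytically along the direction $d$ to a function $\varphi_1\in\mathbb E^d_{q;\tilde s_1}$, and if, successively for $1\le j<r$, $\mathcal L^d_{q;\tilde s_j}\varphi_j$ continues analytically along the direction $d$ to a function $\varphi_{j+1}\in\mathbb E^d_{q;\tilde s_{j+1}}$. Its sum is then $\mathcal S^d_{q;\vec s}(f)=\mathcal L^d_{q;\tilde s_r}\varphi_r$. For $\vec s=(1)$ one has $\tilde s_1=1$, and for $\vec s=(1,2)$ one has $(\tilde s_1,\tilde s_2)=(2,2)$. For $a\in\mathbb C^*$ let $E_{a,q}=\sum_{n\ge0}(-1)^na^{-n-1}q^{n(n-1)/2}x^n$ be the unique formal power series solution of $x\,y(qx)+a\,y(x)=1$,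 and for $m\ge 0$ let $E^{[m]}_{a,q}=\partial_a^mE_{a,q}$ (coefficientwise derivative). **Statement.** Let $a,b\in\mathbb C^*$, let $m,n\ge1$ be integers, and let $d\in\mathbb R$ with $d\notin\big(\arg(-a)+2\pi\mathbb Z\big)\cup\big(\arg(-b)+2\pi\mathbb Z\big)$. Then $E^{[m]}_{a,q}$ and $E^{[n]}_{b,q}$ are $q$-multisummable of order $(1)$ in the direction $d$, the product $E^{[m]}_{a,q}E^{[n]}_{b,q}$ is $q$-multisummable of order $(1,2)$ in the direction $d$, the integrals defining the three sums converge at every point of $\widetilde{\mathbb C}^*$, and for all $x\in\widetilde{\mathbb C}^*$ $$\mathcal S^d_{q;(1,2)}\big(E^{[m]}_{a,q}E^{[n]}_{b,q}\big)(x)=\mathcal S^d_{q;1}\big(E^{[m]}_{a,q}\big)(x)\;\mathcal S^d_{q;1}\big(E^{[n]}_{b,q}\big)(x).$$ -/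

import Mathlib

open MeasureTheory

noncomputable section

namespace QSummation

/-! ### Formal series -/

/-- The formal `q`-Borel transform of order one,
`∑ aₙ xⁿ ↦ ∑ aₙ q^{-n(n-1)/2} ξⁿ`. -/
def formalBorel (q : ℝ) (f : PowerSeries ℂ) : PowerSeries ℂ :=
  PowerSeries.mk fun n => PowerSeries.coeff n f * ((q : ℂ) ^ (n * (n - 1) / 2))⁻¹

/-- `f ∈ ℂ{x}`: the power series `f` has a positive radius of convergence. -/
def IsConvergent (f : PowerSeries ℂ) : Prop :=
  ∃ r : ℝ, 0 < r ∧ Summable fun n : ℕ => ‖PowerSeries.coeff n f‖ * r ^ n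

/-- The `q`-Euler series with parameter `a ≠ 0`, the unique formal solution of
`x y(qx) + a y(x) = 1` (see `eulerSeries_iff`). -/
def eulerSeries (q : ℝ) (a : ℂ) : PowerSeries ℂ :=
  PowerSeries.mk fun n => (-1) ^ n * (q : ℂ) ^ (n * (n - 1) / 2) * (a ^ (n + 1))⁻¹

/-- The `m`-th formal (i.e. coefficientwise) derivative of the `q`-Euler series with respect to
its parameter, `∂ₐᵐ E_{a,q}`. -/
def eulerSeriesDeriv (q : ℝ) (m : ℕ) (a : ℂ) : PowerSeries ℂ :=
  PowerSeries.mk fun n => iteratedDeriv m (fun α => PowerSeries.coeff n (eulerSeries q α)) a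

theorem eulerSeries_iff (q : ℝ) {a : ℂ} (ha : a ≠ 0) (y : PowerSeries ℂ) :
    PowerSeries.X * PowerSeries.rescale (q : ℂ) y + PowerSeries.C a * y = 1 ↔
      y = eulerSeries q a := by
  have tri : ∀ n : ℕ, (n + 1) * (n + 1 - 1) / 2 = n * (n - 1) / 2 + n := Nat.triangle_succ
  constructor
  · intro h
    ext n
    induction n with
    | zero =>
      have h0 := congrArg (PowerSeries.coeff 0) h
      simp at h0
      simp only [eulerSeries, PowerSeries.coeff_mk]
      simp
      field_simp
      linear_combination h0
    | succ n ih =>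
      have h1 := congrArg (PowerSeries.coeff (n + 1)) h
      simp [PowerSeries.coeff_succ_X_mul, PowerSeries.coeff_one] at h1
      rw [ih] at h1
      simp only [eulerSeries, PowerSeries.coeff_mk] at h1 ⊢
      rw [tri]
      apply mul_left_cancel₀ ha
      rw [eq_neg_of_add_eq_zero_right h1]
      field_simp
      ring
  · rintro rfl
    ext n
    cases n with
    | zero => simp [eulerSeries, ha]
    | succ n =>
      simp [PowerSeries.coeff_succ_X_mul, PowerSeries.coeff_one, eulerSeries]
      have h2 := tri n
      simp only [Nat.add_sub_cancel] at h2
      rw [h2]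
      field_simp
      ring

/-! ### The Riemann surface of the logarithm -/

/-- The Riemann surface of the logarithm, in its global holomorphic coordinate `log`: the complex
number `w` stands for the point of modulus `exp (re w)` and argument `im w`. Functions on it are
holomorphic precisely when they are holomorphic in this coordinate. -/
abbrev LogSurface : Type := ℂ

/-- The modulus `|x|` of a point. -/
def modulus (x : LogSurface) : ℝ := Real.exp x.re

/-- The argument of a point. -/
def argument (x : LogSurface) : ℝ := x.im

/-- The projection of the surface onto `ℂ ∖ {0}`. -/
def proj (x : LogSurface) : ℂ := Complex.exp x

/-- The open sector of points with `|arg ξ - d| < ε`. -/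
def sector (d ε : ℝ) : Set LogSurface := {ξ | |argument ξ - d| < ε}

/-- The point `eˢ e^{id}` on the half-line of argument `d`. -/
def rayPoint (d s : ℝ) : LogSurface := (s : ℂ) + (d : ℂ) * Complex.I

/-- Two functions coincide near the origin in some sector around the direction `d`. For `φ`
holomorphic in a sector around `d`, this says that `φ` is the analytic continuation of `g` along
the direction `d`. -/
def EqNearZero (d : ℝ) (g φ : LogSurface → ℂ) : Prop :=
  ∃ ε : ℝ, 0 < ε ∧ ∃ R : ℝ, 0 < R ∧ ∀ x ∈ sector d ε, modulus x < R → g x = φ x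

/-! ### Analytic transformations -/

/-- The space `𝔼^d_{q;1}`: functions analytic in a sector around `d`, bounded near the origin and
of `q`-exponential growth of order one at infinity there. -/
def MemE (q d : ℝ) (φ : LogSurface → ℂ) : Prop :=
  ∃ ε : ℝ, 0 < ε ∧ DifferentiableOn ℂ φ (sector d ε) ∧
    ∃ A : ℝ, 0 < A ∧ ∃ R : ℝ, 0 < R ∧ ∃ C : ℝ,
      (∀ ξ ∈ sector d ε, modulus ξ ≤ R → ‖φ ξ‖ ≤ C) ∧
      (∀ ξ ∈ sector d ε, R < modulus ξ →
        ‖φ ξ‖ * Real.exp (-(Real.log (A * modulus ξ)) ^ 2 / (2 * Real.log q)) ≤ C)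

/-- The integrand `exp (-(log (x / (√q ξ)))² / (2 log q)) φ(ξ)` of the `q`-Laplace transform, at
`ξ = eˢ e^{id}`; the measure `dξ/ξ` on the half-line is `ds`. -/
def laplaceIntegrand (q d : ℝ) (φ : LogSurface → ℂ) (x : LogSurface) (s : ℝ) : ℂ :=
  Complex.exp (-(x - (Real.log (Real.sqrt q) : ℂ) - rayPoint d s) ^ 2 / (2 * (Real.log q : ℂ))) *
    φ (rayPoint d s)

/-- The `q`-Laplace transform of order one in the direction `d`. It is meaningful at the points `x`
for which `laplaceIntegrand q d φ x` is integrable. -/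
def qLaplace (q d : ℝ) (φ : LogSurface → ℂ) (x : LogSurface) : ℂ :=
  ((Real.sqrt (2 * Real.pi * Real.log q))⁻¹ : ℂ) * ∫ s : ℝ, laplaceIntegrand q d φ x s

/-- `q^{1/k}`: an object of order `k` for `q` is the object of order one for `q^{1/k}`. -/
def qRoot (q : ℝ) (k : ℚ) : ℝ := q ^ (1 / (k : ℝ))

/-! ### Multisummation -/

/-- The auxiliary orders `s̃ᵢ = 1 / (1/sᵢ - 1/sᵢ₊₁)`, where the order following the last one
is `∞`. -/
def tildeOrder {r : ℕ} (s : Fin (r + 1) → ℚ) (i : Fin (r + 1)) : ℚ :=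
  (1 / s i - if h : (i : ℕ) + 1 < r + 1 then 1 / s ⟨(i : ℕ) + 1, h⟩ else 0)⁻¹

/-- The successive functions met in the multisummation of `f` of order `s` in the direction `d`:
`φ 0` is the continuation along `d` of the sum of the formal `q`-Borel transform of order `s 0`
of `f`, each following function is the continuation along `d` of the `q`-Laplace transform
(of order `s̃ⱼ`) of the preceding one, and `φ j` lies in `𝔼^d_{q;s̃ⱼ}`. -/
structure IsTower (q : ℝ) {r : ℕ} (s : Fin (r + 1) → ℚ) (d : ℝ) (f : PowerSeries ℂ)
    (φ : Fin (r + 1) → LogSurface → ℂ) : Prop where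
  borel_convergent : IsConvergent (formalBorel (qRoot q (s 0)) f)
  continuation_borel : EqNearZero d
    (fun x => ∑' n : ℕ, PowerSeries.coeff n (formalBorel (qRoot q (s 0)) f) * proj x ^ n) (φ 0)
  continuation_laplace : ∀ j : Fin r,
    EqNearZero d (qLaplace (qRoot q (tildeOrder s j.castSucc)) d (φ j.castSucc)) (φ j.succ)
  mem_E : ∀ j, MemE (qRoot q (tildeOrder s j)) d (φ j)

/-- `f ∈ ℂ[[x]]^d_{q;s}`: `f` is `q`-multisummable of order `s` in the direction `d`, where the
order `s` is a nonempty strictly increasing sequence of positive rational numbers. -/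
def QMultisummable (q : ℝ) {r : ℕ} (s : Fin (r + 1) → ℚ) (d : ℝ) (f : PowerSeries ℂ) : Prop :=
  (∀ i, 0 < s i) ∧ StrictMono s ∧ ∃ φ, IsTower q s d f φ

open Classical in
/-- The multisum `𝒮^d_{q;s}(f)`, the last `q`-Laplace transform of the procedure (and `0` if `f` is
not multisummable). It does not depend on the choice of the functions (see `IsTower.qSum_eq`). -/
def qSum (q : ℝ) {r : ℕ} (s : Fin (r + 1) → ℚ) (d : ℝ) (f : PowerSeries ℂ)
    (x : LogSurface) : ℂ :=
  if h : ∃ φ, IsTower q s d f φ then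
    qLaplace (qRoot q (tildeOrder s (Fin.last r))) d (h.choose (Fin.last r)) x
  else 0

/-- The Laplace integral which defines the multisum of `f` converges at the point `x`. -/
def QSumConvergesAt (q : ℝ) {r : ℕ} (s : Fin (r + 1) → ℚ) (d : ℝ) (f : PowerSeries ℂ)
    (x : LogSurface) : Prop :=
  ∃ φ, IsTower q s d f φ ∧
    Integrable (laplaceIntegrand (qRoot q (tildeOrder s (Fin.last r))) d (φ (Fin.last r)) x)

/-! ### The multisum is well defined -/

theorem EqNearZero.eq_on_ray {q q' d : ℝ} {g φ ψ : LogSurface → ℂ}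
    (hφ : EqNearZero d g φ) (hψ : EqNearZero d g ψ) (mφ : MemE q d φ) (mψ : MemE q' d ψ)
    (s : ℝ) : φ (rayPoint d s) = ψ (rayPoint d s) := by
  obtain ⟨ε₁, h1, R₁, hR1, e1⟩ := hφ
  obtain ⟨ε₂, h2, R₂, hR2, e2⟩ := hψ
  obtain ⟨ε₃, h3, d3, -⟩ := mφ
  obtain ⟨ε₄, h4, d4, -⟩ := mψ
  set ε := min (min ε₁ ε₂) (min ε₃ ε₄) with hε
  have hpos : 0 < ε := by positivity
  have sub : ∀ δ, ε ≤ δ → sector d ε ⊆ sector d δ := fun δ hδ x hx => lt_of_lt_of_le hx hδ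
  have hopen : IsOpen (sector d ε) := by
    have : Continuous fun x : ℂ => |x.im - d| := by fun_prop
    exact isOpen_lt this continuous_const
  have hconv : Convex ℝ (sector d ε) := by
    have : sector d ε = Complex.imLm ⁻¹' (Metric.ball d ε) := by
      ext x; simp [sector, argument, Real.dist_eq]
    rw [this]
    exact (convex_ball d ε).linear_preimage Complex.imLm
  have hray : ∀ t, rayPoint d t ∈ sector d ε := by
    intro t; simp [rayPoint, sector, argument, hpos]
  have hR : 0 < min R₁ R₂ := lt_min hR1 hR2
  set t₀ := Real.log (min R₁ R₂) - 1
  have hev : φ =ᶠ[nhds (rayPoint d t₀)] ψ := by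
    have hU : IsOpen {x : LogSurface | modulus x < min R₁ R₂} := by
      have : Continuous fun x : ℂ => Real.exp x.re := by fun_prop
      exact isOpen_lt this continuous_const
    have hm : rayPoint d t₀ ∈ {x : LogSurface | modulus x < min R₁ R₂} := by
      have : Real.exp t₀ < min R₁ R₂ := by
        rw [← Real.lt_log_iff_exp_lt hR]; simp [t₀]
      simpa [modulus, rayPoint] using this
    filter_upwards [hopen.mem_nhds (hray t₀), hU.mem_nhds hm] with x hx hx'
    rw [← e1 x (sub _ (by simp [hε]) hx) (lt_of_lt_of_le hx' (min_le_left _ _)),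
      ← e2 x (sub _ (by simp [hε]) hx) (lt_of_lt_of_le hx' (min_le_right _ _))]
  exact ((d3.mono (sub _ (by simp [hε]))).analyticOnNhd hopen).eqOn_of_preconnected_of_eventuallyEq
    ((d4.mono (sub _ (by simp [hε]))).analyticOnNhd hopen) hconv.isPreconnected (hray t₀) hev
    (hray s)

theorem qLaplace_congr {q d : ℝ} {φ ψ : LogSurface → ℂ}
    (h : ∀ s, φ (rayPoint d s) = ψ (rayPoint d s)) : qLaplace q d φ = qLaplace q d ψ := by
  funext x
  simp only [qLaplace, laplaceIntegrand, h]

theorem IsTower.eq_on_ray {q : ℝ} {r : ℕ} {s : Fin (r + 1) → ℚ} {d : ℝ} {f : PowerSeries ℂ}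
    {φ ψ : Fin (r + 1) → LogSurface → ℂ} (hφ : IsTower q s d f φ) (hψ : IsTower q s d f ψ)
    (j : Fin (r + 1)) (t : ℝ) : φ j (rayPoint d t) = ψ j (rayPoint d t) := by
  induction j using Fin.induction generalizing t with
  | zero => exact hφ.continuation_borel.eq_on_ray hψ.continuation_borel (hφ.mem_E 0) (hψ.mem_E 0) t
  | succ j ih =>
    have h := hφ.continuation_laplace j
    rw [qLaplace_congr ih] at h
    exact h.eq_on_ray (hψ.continuation_laplace j) (hφ.mem_E _) (hψ.mem_E _) t

theorem IsTower.qSum_eq {q : ℝ} {r : ℕ} {s : Fin (r + 1) → ℚ} {d : ℝ} {f : PowerSeries ℂ}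
    {φ : Fin (r + 1) → LogSurface → ℂ} (hφ : IsTower q s d f φ) :
    qSum q s d f = qLaplace (qRoot q (tildeOrder s (Fin.last r))) d (φ (Fin.last r)) := by
  have h : ∃ φ, IsTower q s d f φ := ⟨φ, hφ⟩
  funext x
  rw [qSum, dif_pos h, qLaplace_congr (h.choose_spec.eq_on_ray hφ (Fin.last r))]

end QSummation

end

namespace QSummation

open Filter Topology

/-! ### Holomorphic parameter integrals -/

/-! Write L = log q and work in the coordinate log ξ. A q-Laplace transform becomes, up to a
constant and a shift, integration along a horizontal line against a Gaussian: exp(-z²/(2L)) for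
order 1, exp(-z²/L) for order 2. The order-one Borel transform of `eulerSeriesDeriv q m a` is (-1)^m
m! (a + ξ)^(-m-1), which is bounded on a thin sector avoiding -a, so each factor is summed by a
single integral that converges everywhere.

The product formula comes from a midpoint change of variables (`rayConv_mul_rayConv`): a product of
two order-one integrals is one order-two integral of the bounded function `gaussCorr`. What remains
is to show that multisummation of the product does lead to this function.

The Borel transform of the product is ∑ β_j γ_k q^(-jk) ξ^(j+k). Grouping the terms by N = min(j, k)
rewrites it as ∑ q^(-N²) ξ^(2N) C_N(ξ/q^N), where C_N is `crossTerm`, made of Taylor remainders of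
the two factors (`TaylorFamily.tsum_borelConv`, `TaylorFamily.mixedSeries_eq_gaussSeries`). These
remainders are bounded by M K^N on the whole sector, so the factor q^(-N²) makes the new series
converge on all of it, with q-exponential growth of order two (`memE_gaussSeries`).

The order-two Laplace transform of that series can be computed termwise near the origin
(`rayConv_gaussSeries`). Peeling Taylor coefficients off both factors expands `gaussCorr` into the
same terms (`TaylorFamily.gaussCorr_step`), whence the two agree there
(`TaylorFamily.rayConv_gaussSeries_eq`). -/

theorem differentiableOn_integral_of_locally_dominated {F : ℂ → ℝ → ℂ} {U : Set ℂ} (hU : IsOpen U)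
    (hmeas : ∀ x ∈ U, AEStronglyMeasurable (F x)) (hdiff : ∀ s, DifferentiableOn ℂ (F · s) U)
    (hdom : ∀ x₀ ∈ U, ∃ r : ℝ, 0 < r ∧ ∃ g : ℝ → ℝ, Integrable g ∧
      ∀ x ∈ U, dist x x₀ < r → ∀ s, ‖F x s‖ ≤ g s) :
    DifferentiableOn ℂ (fun x => ∫ s, F x s) U := by
  classical
  intro x₀ hx₀
  obtain ⟨r₁, hr₁, g, hg, hFg⟩ := hdom x₀ hx₀
  obtain ⟨r₂, hr₂, hball⟩ := Metric.isOpen_iff.1 hU x₀ hx₀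
  set r := min r₁ r₂ with hr_def
  have hr : 0 < r := lt_min hr₁ hr₂
  have hrU : ∀ x, dist x x₀ < r → x ∈ U := fun x hx => hball (hx.trans_le (min_le_right _ _))
  have hrg : ∀ x, dist x x₀ < r → ∀ s, ‖F x s‖ ≤ g s := fun x hx =>
    hFg x (hrU x hx) (hx.trans_le (min_le_left _ _))
  have hderiv : ∀ s x, dist x x₀ < r → HasDerivAt (F · s) (deriv (F · s) x) x := fun s x hx =>
    ((hdiff s).differentiableAt (hU.mem_nhds (hrU x hx))).hasDerivAt
  have hself : dist x₀ x₀ < r := by simpa using hr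
  -- The derivative is a pointwise limit of difference quotients; these are replaced by 0 off `U`,
  -- where nothing is known about measurability.
  have hF' : AEStronglyMeasurable (fun s => deriv (F · s) x₀) := by
    refine aestronglyMeasurable_of_tendsto_ae (𝓝[≠] x₀)
      (f := fun x s => if x ∈ U then slope (F · s) x₀ x else 0) (fun x => ?_)
      (Eventually.of_forall fun s => ?_)
    · by_cases hx : x ∈ U
      · simp only [hx, if_true, slope_def_field]
        have := ((hmeas x hx).sub (hmeas x₀ hx₀)).mul (aestronglyMeasurable_const (b := (x - x₀)⁻¹))
        simpa only [div_eq_mul_inv] using! this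
      · simpa only [hx, if_false] using aestronglyMeasurable_const
    · refine (hderiv s x₀ hself).tendsto_slope.congr' ?_
      filter_upwards [mem_nhdsWithin_of_mem_nhds (hU.mem_nhds hx₀)] with x hx
      simp only [hx, if_true]
  -- Cauchy's estimate on circles of radius r/2 centred in the half ball turns the bound g on F into
  -- the bound g / (r/2) on its derivative.
  refine (hasDerivAt_integral_of_dominated_loc_of_deriv_le
    (F' := fun x s => deriv (F · s) x) (bound := fun s => g s / (r / 2))
    (Metric.ball_mem_nhds x₀ (half_pos hr)) ?_ ?_ hF' (Eventually.of_forall fun s x hx => ?_)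
    (hg.div_const _) (Eventually.of_forall fun s x hx => hderiv s x ?_)).2.differentiableAt
      |>.differentiableWithinAt
  · filter_upwards [hU.mem_nhds hx₀] with x hx using hmeas x hx
  · exact hg.mono' (hmeas x₀ hx₀) (Eventually.of_forall fun s => hrg x₀ hself s)
  · have hsub : ∀ z, dist z x ≤ r / 2 → dist z x₀ < r := fun z hz => by
      have := dist_triangle z x x₀
      rw [Metric.mem_ball] at hx
      linarith
    refine Complex.norm_deriv_le_of_forall_mem_sphere_norm_le (half_pos hr) ?_
      fun z hz => hrg z (hsub z (le_of_eq hz)) s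
    refine DifferentiableOn.diffContOnCl fun z hz => ?_
    rw [closure_ball _ (half_pos hr).ne'] at hz
    exact (hderiv s z (hsub z hz)).differentiableAt.differentiableWithinAt
  · rw [Metric.mem_ball] at hx
    linarith

/-! ### Sectors and Gaussian kernels -/

theorem isOpen_sector (d ε : ℝ) : IsOpen (sector d ε) := by
  have : Continuous fun x : ℂ => |x.im - d| := by fun_prop
  exact isOpen_lt this continuous_const

theorem convex_sector (d ε : ℝ) : Convex ℝ (sector d ε) := by
  have : sector d ε = Complex.imLm ⁻¹' (Metric.ball d ε) := by
    ext x; simp [sector, argument, Real.dist_eq]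
  rw [this]
  exact (convex_ball d ε).linear_preimage Complex.imLm

theorem sector_mono {d ε ε' : ℝ} (h : ε ≤ ε') : sector d ε ⊆ sector d ε' :=
  fun _ hx => lt_of_lt_of_le hx h

theorem rayPoint_mem_sector {d ε : ℝ} (hε : 0 < ε) (s : ℝ) : rayPoint d s ∈ sector d ε := by
  simp [rayPoint, sector, argument, hε]

theorem add_ofReal_mem_sector {d ε : ℝ} {x : ℂ} (hx : x ∈ sector d ε) (t : ℝ) :
    x + t ∈ sector d ε := by
  simpa [sector, argument] using hx

theorem sub_ofReal_mem_sector {d ε : ℝ} {x : ℂ} (hx : x ∈ sector d ε) (t : ℝ) :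
    x - t ∈ sector d ε := by
  simpa [sector, argument] using hx

theorem continuous_rayPoint (d : ℝ) : Continuous (rayPoint d) := by
  unfold rayPoint; fun_prop

theorem continuous_comp_sector {d ε : ℝ} {X : Type*} [TopologicalSpace X] {h : ℂ → ℂ} {u : X → ℂ}
    (hh : DifferentiableOn ℂ h (sector d ε)) (hu : Continuous u) (hmem : ∀ t, u t ∈ sector d ε) :
    Continuous fun t => h (u t) :=
  hh.continuousOn.comp_continuous hu hmem

theorem integrable_gaussian {L : ℝ} (hL : 0 < L) (c : ℝ) :
    Integrable fun s : ℝ => Real.exp (-(s - c) ^ 2 / L) := by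
  have h := (integrable_exp_neg_mul_sq (b := 1 / L) (by positivity)).comp_sub_right c
  refine h.congr (Eventually.of_forall fun s => ?_)
  simp only
  congr 1
  ring

theorem norm_cexp_neg_sq_div (z : ℂ) (L : ℝ) :
    ‖Complex.exp (-z ^ 2 / L)‖ = Real.exp (-(z.re ^ 2 - z.im ^ 2) / L) := by
  rw [Complex.norm_exp, Complex.div_ofReal_re]
  simp [pow_two]

theorem norm_kernel (L d s : ℝ) (y : ℂ) :
    ‖Complex.exp (-(y - rayPoint d s) ^ 2 / L)‖ =
      Real.exp ((y.im - d) ^ 2 / L) * Real.exp (-(s - y.re) ^ 2 / L) := by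
  rw [norm_cexp_neg_sq_div, ← Real.exp_add]
  simp only [rayPoint, Complex.sub_re, Complex.add_re, Complex.ofReal_re, Complex.mul_re,
    Complex.I_re, Complex.ofReal_im, Complex.I_im, Complex.sub_im, Complex.add_im, Complex.mul_im]
  congr 1
  ring

theorem norm_cexp_real_gaussian (L t : ℝ) :
    ‖Complex.exp (-(t : ℂ) ^ 2 / L)‖ = Real.exp (-t ^ 2 / L) := by
  rw [norm_cexp_neg_sq_div]; simp

/-- The integral of `h` along the ray of argument `d` against a Gaussian kernel centred at `y`. -/
noncomputable def rayConv (L d : ℝ) (h : ℂ → ℂ) (y : ℂ) : ℂ :=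
  ∫ s : ℝ, Complex.exp (-(y - rayPoint d s) ^ 2 / L) * h (rayPoint d s)

/-- `h` is holomorphic and bounded by `B` on the sector. -/
structure BoundedHol (d ε B : ℝ) (h : ℂ → ℂ) : Prop where
  diff : DifferentiableOn ℂ h (sector d ε)
  bound : ∀ x ∈ sector d ε, ‖h x‖ ≤ B

theorem BoundedHol.nonneg {d ε B : ℝ} {h : ℂ → ℂ} (hh : BoundedHol d ε B h) (hε : 0 < ε) :
    0 ≤ B :=
  (norm_nonneg _).trans (hh.bound _ (rayPoint_mem_sector hε 0))

theorem BoundedHol.const_mul {d ε B : ℝ} {h : ℂ → ℂ} (hh : BoundedHol d ε B h) (c : ℂ) :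
    BoundedHol d ε (‖c‖ * B) fun x => c * h x where
  diff := hh.diff.const_mul c
  bound x hx := by
    rw [norm_mul]
    exact mul_le_mul_of_nonneg_left (hh.bound x hx) (norm_nonneg c)

theorem BoundedHol.integrable_kernel {L d ε B : ℝ} {h : ℂ → ℂ} (hh : BoundedHol d ε B h)
    (hL : 0 < L) (hε : 0 < ε) (y : ℂ) :
    Integrable fun s : ℝ => Complex.exp (-(y - rayPoint d s) ^ 2 / L) * h (rayPoint d s) := by
  have hc : Continuous fun s : ℝ => h (rayPoint d s) :=
    continuous_comp_sector hh.diff (continuous_rayPoint d) (rayPoint_mem_sector hε)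
  have hr := continuous_rayPoint d
  refine (((integrable_gaussian hL y.re).const_mul (Real.exp ((y.im - d) ^ 2 / L))).mul_const
    B).mono' (Continuous.mul (by fun_prop) hc).aestronglyMeasurable
    (Eventually.of_forall fun s => ?_)
  rw [norm_mul, norm_kernel]
  gcongr
  exact hh.bound _ (rayPoint_mem_sector hε s)

theorem BoundedHol.integral_norm_kernel_le {L d ε B : ℝ} {h : ℂ → ℂ} (hh : BoundedHol d ε B h)
    (hL : 0 < L) (hε : 0 < ε) (y : ℂ) :
    ∫ s : ℝ, ‖Complex.exp (-(y - rayPoint d s) ^ 2 / L) * h (rayPoint d s)‖ ≤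
      Real.exp ((y.im - d) ^ 2 / L) * (∫ t : ℝ, Real.exp (-t ^ 2 / L)) * B := by
  have hi := ((integrable_gaussian hL y.re).const_mul (Real.exp ((y.im - d) ^ 2 / L))).mul_const B
  calc _ ≤ ∫ s : ℝ, Real.exp ((y.im - d) ^ 2 / L) * Real.exp (-(s - y.re) ^ 2 / L) * B := by
        refine integral_mono (hh.integrable_kernel hL hε y).norm hi fun s => ?_
        simp only
        rw [norm_mul, norm_kernel]
        gcongr
        exact hh.bound _ (rayPoint_mem_sector hε s)
    _ = _ := by
        rw [integral_mul_const, integral_const_mul,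
          integral_sub_right_eq_self (fun s : ℝ => Real.exp (-s ^ 2 / L)) y.re]

/-- Only the entire kernel depends on the point, while h is evaluated on the ray; hence the result
is entire although h lives on a sector. -/
theorem BoundedHol.differentiable_rayConv {L d ε B : ℝ} {h : ℂ → ℂ} (hh : BoundedHol d ε B h)
    (hL : 0 < L) (hε : 0 < ε) : DifferentiableOn ℂ (rayConv L d h) Set.univ := by
  refine differentiableOn_integral_of_locally_dominated isOpen_univ
    (fun x _ => (hh.integrable_kernel hL hε x).aestronglyMeasurable)
    (fun s => Differentiable.differentiableOn (by fun_prop)) fun x₀ _ => ⟨1, one_pos, ?_⟩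
  -- Doubling the width absorbs a displacement of the centre by at most 1, since (s - x₀)²/2 ≤ (s -
  -- x)² + 1.
  refine ⟨_, ((integrable_gaussian (L := 2 * L) (by positivity) x₀.re).const_mul
    (Real.exp ((|x₀.im - d| + 1) ^ 2 / L) * Real.exp (1 / L))).mul_const B, fun x _ hx s => ?_⟩
  have hre : |x.re - x₀.re| ≤ 1 := by
    rw [dist_eq_norm] at hx
    simpa using (Complex.abs_re_le_norm (x - x₀)).trans hx.le
  have him : |x.im - x₀.im| ≤ 1 := by
    rw [dist_eq_norm] at hx
    simpa using (Complex.abs_im_le_norm (x - x₀)).trans hx.le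
  rw [norm_mul, norm_kernel, ← Real.exp_add, ← Real.exp_add, ← Real.exp_add, add_assoc]
  have h1 : (x.im - d) ^ 2 ≤ (|x₀.im - d| + 1) ^ 2 := by
    refine sq_le_sq' ?_ ?_ <;>
      linarith [abs_le.1 him, neg_abs_le (x₀.im - d), le_abs_self (x₀.im - d), (abs_le.1 him).1,
        (abs_le.1 him).2]
  have h2 : -(s - x.re) ^ 2 / L ≤ 1 / L + -(s - x₀.re) ^ 2 / (2 * L) := by
    have h3 : (x.re - x₀.re) ^ 2 ≤ 1 := by
      rw [sq_le_one_iff_abs_le_one]; exact hre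
    have h4 : 1 / L + -(s - x₀.re) ^ 2 / (2 * L) = (1 - (s - x₀.re) ^ 2 / 2) / L := by
      field_simp; ring
    rw [h4]
    gcongr
    nlinarith [sq_nonneg (s - x.re + (s - x.re) - (s - x₀.re))]
  have hb := hh.bound _ (rayPoint_mem_sector hε s)
  have hB := hh.nonneg hε
  refine mul_le_mul (Real.exp_le_exp.2 (add_le_add ?_ h2)) hb (norm_nonneg _) (Real.exp_nonneg _)
  gcongr

theorem integrable_gauss {L B : ℝ} {g : ℝ → ℂ} (hL : 0 < L)
    (hg : Continuous g) (hb : ∀ t, ‖g t‖ ≤ B) :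
    Integrable fun t : ℝ => Complex.exp (-(t : ℂ) ^ 2 / L) * g t := by
  have hi := integrable_gaussian hL 0
  simp only [sub_zero] at hi
  refine (hi.mul_const B).mono' (by fun_prop) (Eventually.of_forall fun s => ?_)
  rw [norm_mul, norm_cexp_real_gaussian]
  gcongr
  exact hb s

theorem norm_integral_gauss_le {L B : ℝ} {g : ℝ → ℂ} (hL : 0 < L) (hb : ∀ t, ‖g t‖ ≤ B) :
    ‖∫ t : ℝ, Complex.exp (-(t : ℂ) ^ 2 / L) * g t‖ ≤ (∫ t : ℝ, Real.exp (-t ^ 2 / L)) * B := by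
  have hi := integrable_gaussian hL 0
  simp only [sub_zero] at hi
  rw [← integral_mul_const]
  refine norm_integral_le_of_norm_le (hi.mul_const B) (Eventually.of_forall fun s => ?_)
  rw [norm_mul, norm_cexp_real_gaussian]
  gcongr
  exact hb s

theorem differentiableOn_integral_gauss {L B : ℝ} (hL : 0 < L) {U : Set ℂ} (hU : IsOpen U)
    {F : ℂ → ℝ → ℂ} (hdiff : ∀ t, DifferentiableOn ℂ (F · t) U)
    (hcont : ∀ x ∈ U, Continuous (F x)) (hb : ∀ x ∈ U, ∀ t, ‖F x t‖ ≤ B) :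
    DifferentiableOn ℂ (fun x => ∫ t : ℝ, Complex.exp (-(t : ℂ) ^ 2 / L) * F x t) U := by
  have hi := integrable_gaussian hL 0
  simp only [sub_zero] at hi
  refine differentiableOn_integral_of_locally_dominated hU (fun x hx => ?_)
    (fun s => (hdiff s).const_mul _) fun x₀ _ => ⟨1, one_pos, _, hi.mul_const B, fun x hx _ s => ?_⟩
  · have := hcont x hx
    fun_prop
  · rw [norm_mul, norm_cexp_real_gaussian]
    gcongr
    exact hb x hx s

/-- Two holomorphic functions on an open convex set which agree on a piece of the ray agree. -/
theorem eqOn_of_eq_on_ray {d σ : ℝ} {U : Set ℂ} (hU : IsOpen U) (hconv : Convex ℝ U)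
    {f g : ℂ → ℂ} (hf : DifferentiableOn ℂ f U) (hg : DifferentiableOn ℂ g U)
    (hσ : rayPoint d σ ∈ U) (h : ∀ s, rayPoint d s ∈ U → f (rayPoint d s) = g (rayPoint d s)) :
    Set.EqOn f g U := by
  refine (hf.analyticOnNhd hU).eqOn_of_preconnected_of_frequently_eq (hg.analyticOnNhd hU)
    hconv.isPreconnected hσ ?_
  have hne : ∃ᶠ s in 𝓝[≠] σ, rayPoint d s ∈ U := by
    refine Eventually.frequently (mem_nhdsWithin_of_mem_nhds ?_)
    exact (continuous_rayPoint d).continuousAt.preimage_mem_nhds (hU.mem_nhds hσ)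
  have ht : Tendsto (rayPoint d) (𝓝[≠] σ) (𝓝[≠] (rayPoint d σ)) := by
    refine tendsto_nhdsWithin_of_tendsto_nhds_of_eventually_within _
      ((continuous_rayPoint d).continuousAt.tendsto.mono_left nhdsWithin_le_nhds) ?_
    filter_upwards [self_mem_nhdsWithin] with s hs
    simpa [rayPoint] using hs
  exact ht.frequently (hne.mono fun s hs => h s hs)

/-- Moving the contour: the Gaussian mean of `h` around a point `y` of the sector, taken along the
horizontal line through `y`, can be computed along the ray. -/
theorem BoundedHol.integral_gauss_eq_rayConv {L d ε B : ℝ} {h : ℂ → ℂ} (hh : BoundedHol d ε B h)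
    (hL : 0 < L) (hε : 0 < ε) {y : ℂ} (hy : y ∈ sector d ε) :
    ∫ t : ℝ, Complex.exp (-(t : ℂ) ^ 2 / L) * h (y + t) = rayConv L d h y := by
  -- Both sides are holomorphic in y on the sector and agree on the ray by a real translation; the
  -- identity theorem replaces a contour deformation.
  refine eqOn_of_eq_on_ray (f := fun y => ∫ t : ℝ, Complex.exp (-(t : ℂ) ^ 2 / L) * h (y + t))
    (isOpen_sector d ε) (convex_sector d ε) ?_ ((hh.differentiable_rayConv hL hε).mono (Set.subset_univ _)) (rayPoint_mem_sector hε 0)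
    (fun s _ => ?_) hy
  · refine differentiableOn_integral_gauss hL (isOpen_sector d ε) (B := B) (fun t => ?_)
      (fun x hx => ?_) fun x hx t => hh.bound _ (add_ofReal_mem_sector hx t)
    · exact hh.diff.comp (by fun_prop) fun x hx => add_ofReal_mem_sector hx t
    · exact continuous_comp_sector hh.diff (by fun_prop) (add_ofReal_mem_sector hx)
  · rw [rayConv, ← integral_add_right_eq_self (fun t : ℝ => Complex.exp
      (-(rayPoint d s - rayPoint d t) ^ 2 / L) * h (rayPoint d t)) s]
    refine integral_congr_ae (Eventually.of_forall fun t => ?_)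
    simp only [rayPoint]
    congr 2
    · push_cast; ring
    · push_cast; ring

/-! ### Products of Gaussian convolutions -/

/-- The Gaussian mean of `f (y + t) g (y - t)`. -/
noncomputable def gaussCorr (L : ℝ) (f g : ℂ → ℂ) (y : ℂ) : ℂ :=
  ∫ t : ℝ, Complex.exp (-(t : ℂ) ^ 2 / L) * (f (y + t) * g (y - t))

theorem BoundedHol.norm_mul_le {d ε B B' : ℝ} {f g : ℂ → ℂ} (hf : BoundedHol d ε B f)
    (hg : BoundedHol d ε B' g) (hε : 0 < ε) {y : ℂ} (hy : y ∈ sector d ε) (t : ℝ) :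
    ‖f (y + t) * g (y - t)‖ ≤ B * B' := by
  rw [norm_mul]
  exact mul_le_mul (hf.bound _ (add_ofReal_mem_sector hy t))
    (hg.bound _ (sub_ofReal_mem_sector hy t)) (norm_nonneg _) (hf.nonneg hε)

theorem BoundedHol.gaussCorr {L d ε B B' : ℝ} {f g : ℂ → ℂ} (hf : BoundedHol d ε B f)
    (hg : BoundedHol d ε B' g) (hL : 0 < L) (hε : 0 < ε) :
    BoundedHol d ε ((∫ t : ℝ, Real.exp (-t ^ 2 / L)) * (B * B')) (gaussCorr L f g) where
  diff := by
    refine differentiableOn_integral_gauss hL (isOpen_sector d ε) (B := B * B') (fun t => ?_)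
      (fun x hx => ?_) fun x hx t => hf.norm_mul_le hg hε hx t
    · exact (hf.diff.comp (by fun_prop) fun x hx => add_ofReal_mem_sector hx t).mul
        (hg.diff.comp (by fun_prop) fun x hx => sub_ofReal_mem_sector hx t)
    · exact (continuous_comp_sector hf.diff (by fun_prop) (add_ofReal_mem_sector hx)).mul
        (continuous_comp_sector hg.diff (by fun_prop) (sub_ofReal_mem_sector hx))
  bound := fun x hx => norm_integral_gauss_le hL fun t => hf.norm_mul_le hg hε hx t

/-- With s = (u + v)/2 one has ((X - u)² + (X - v)²)/(2L) = (X - s)²/L + (u - s)²/L. The pair of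
Gaussians becomes a Gaussian in the midpoint times a Gaussian in the half difference, and the factor
2 is the Jacobian of v = 2s - u. -/
theorem rayConv_mul_rayConv {L d ε B B' : ℝ} {f g : ℂ → ℂ} (hf : BoundedHol d ε B f)
    (hg : BoundedHol d ε B' g) (hL : 0 < L) (hε : 0 < ε) (X : ℂ) :
    rayConv (2 * L) d f X * rayConv (2 * L) d g X = 2 * rayConv L d (gaussCorr L f g) X := by
  have hLc : (L : ℂ) ≠ 0 := by exact_mod_cast hL.ne'
  have hr := continuous_rayPoint d
  have hfc : Continuous fun u : ℝ => f (rayPoint d u) :=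
    continuous_comp_sector hf.diff hr (rayPoint_mem_sector hε)
  have hgc : Continuous fun u : ℝ => g (rayPoint d u) :=
    continuous_comp_sector hg.diff hr (rayPoint_mem_sector hε)
  set J : ℝ → ℝ → ℂ := fun s u => Complex.exp (-(X - rayPoint d s) ^ 2 / L) *
    (Complex.exp (-((u - s : ℝ) : ℂ) ^ 2 / L) * (f (rayPoint d u) * g (rayPoint d (2 * s - u))))
  have hJc : Continuous (Function.uncurry J) := by
    refine Continuous.mul (by fun_prop) (Continuous.mul (by fun_prop) ?_)
    exact (hfc.comp continuous_snd).mul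
      (hgc.comp (f := fun z : ℝ × ℝ => 2 * z.1 - z.2) (by fun_prop))
  have hJi : Integrable (Function.uncurry J) (volume.prod volume) := by
    -- Integrability for Fubini: with a = s - re X and b = u - s, a² + b² ≥ a²/2 + (a + b)²/4, which
    -- decouples s and u into Gaussians of widths 2L and 4L.
    have h1 := integrable_gaussian (L := 2 * L) (by positivity) X.re
    have h2 := integrable_gaussian (L := 4 * L) (by positivity) X.re
    refine (((h1.mul_prod h2).const_mul (Real.exp ((X.im - d) ^ 2 / L))).mul_const
      (B * B')).mono' hJc.aestronglyMeasurable (Eventually.of_forall fun z => ?_)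
    obtain ⟨s, u⟩ := z
    simp only [Function.uncurry, J]
    rw [norm_mul, norm_mul, norm_kernel, norm_cexp_real_gaussian, norm_mul, ← mul_assoc]
    have hB := hf.nonneg hε
    refine mul_le_mul ?_ (mul_le_mul (hf.bound _ (rayPoint_mem_sector hε u))
      (hg.bound _ (rayPoint_mem_sector hε _)) (norm_nonneg _) hB) (by positivity) (by positivity)
    rw [mul_assoc]
    refine mul_le_mul_of_nonneg_left ?_ (Real.exp_nonneg _)
    rw [← Real.exp_add, ← Real.exp_add, Real.exp_le_exp]
    have e1 : -(s - X.re) ^ 2 / L + -(u - s) ^ 2 / L =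
        (-(s - X.re) ^ 2 - (u - s) ^ 2) / L := by ring
    have e2 : -(s - X.re) ^ 2 / (2 * L) + -(u - X.re) ^ 2 / (4 * L) =
        (-(s - X.re) ^ 2 / 2 - (u - X.re) ^ 2 / 4) / L := by field_simp; ring
    rw [e1, e2]
    refine div_le_div_of_nonneg_right ?_ hL.le
    nlinarith [sq_nonneg (s - X.re - (u - s)), sq_nonneg (u - s)]
  have hleft : rayConv L d (gaussCorr L f g) X = ∫ s : ℝ, ∫ u : ℝ, J s u := by
    refine integral_congr_ae (Eventually.of_forall fun s => ?_)
    simp only [J, QSummation.gaussCorr]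
    rw [integral_const_mul]
    congr 1
    rw [← integral_sub_right_eq_self (fun t : ℝ => Complex.exp (-(t : ℂ) ^ 2 / L) *
      (f (rayPoint d s + t) * g (rayPoint d s - t))) s]
    refine integral_congr_ae (Eventually.of_forall fun u => ?_)
    simp only
    congr 3
    · simp only [rayPoint]; push_cast; ring
    · simp only [rayPoint]; push_cast; ring
  have hinner : ∀ u : ℝ, ∫ s : ℝ, J s u =
      (1 / 2) * (Complex.exp (-(X - rayPoint d u) ^ 2 / (2 * L : ℝ)) * f (rayPoint d u) *
        rayConv (2 * L) d g X) := by
    intro u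
    have h1 := Measure.integral_comp_div (fun s : ℝ => J s u) 2
    rw [← integral_add_right_eq_self (fun v : ℝ => J (v / 2) u) u] at h1
    have h2 : ∀ v : ℝ, J ((v + u) / 2) u =
        Complex.exp (-(X - rayPoint d u) ^ 2 / (2 * L : ℝ)) * f (rayPoint d u) *
          (Complex.exp (-(X - rayPoint d v) ^ 2 / (2 * L : ℝ)) * g (rayPoint d v)) := by
      intro v
      have e0 : (2 * ((v + u) / 2) - u : ℝ) = v := by ring
      have e1 : Complex.exp (-(X - rayPoint d ((v + u) / 2)) ^ 2 / L) *
          Complex.exp (-((u - (v + u) / 2 : ℝ) : ℂ) ^ 2 / L) =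
          Complex.exp (-(X - rayPoint d u) ^ 2 / (2 * L : ℝ)) *
            Complex.exp (-(X - rayPoint d v) ^ 2 / (2 * L : ℝ)) := by
        rw [← Complex.exp_add, ← Complex.exp_add]
        congr 1
        simp only [rayPoint]
        push_cast
        field_simp
        ring
      simp only [J, e0]
      rw [← mul_assoc, e1]
      ring
    simp only [h2] at h1
    rw [integral_const_mul] at h1
    rw [rayConv, h1]
    simp
  rw [hleft, integral_integral_swap hJi]
  simp only [hinner]
  rw [integral_const_mul, integral_mul_const, ← mul_assoc]
  simp [rayConv]

/-! ### The `q`-Laplace transform of bounded functions -/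

theorem qLaplace_eq_rayConv {q : ℝ} (hq : 1 < q) (d : ℝ) (φ : ℂ → ℂ) (x : ℂ) :
    qLaplace q d φ x = ((Real.sqrt (2 * Real.pi * Real.log q))⁻¹ : ℂ) *
      rayConv (2 * Real.log q) d φ (x - (Real.log q / 2 : ℝ)) := by
  simp only [qLaplace, laplaceIntegrand, rayConv, Real.log_sqrt (zero_le_one.trans hq.le)]
  push_cast
  rfl

theorem BoundedHol.integrable_laplaceIntegrand {q d ε B : ℝ} {φ : ℂ → ℂ} (hq : 1 < q)
    (hφ : BoundedHol d ε B φ) (hε : 0 < ε) (x : ℂ) : Integrable (laplaceIntegrand q d φ x) := by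
  have h := hφ.integrable_kernel (L := 2 * Real.log q)
    (mul_pos two_pos (Real.log_pos hq)) hε (x - (Real.log (Real.sqrt q) : ℂ))
  refine h.congr (Eventually.of_forall fun s => ?_)
  simp only [laplaceIntegrand]
  push_cast
  rfl

theorem BoundedHol.memE {q d ε B : ℝ} {φ : ℂ → ℂ} (hq : 1 < q) (hφ : BoundedHol d ε B φ)
    (hε : 0 < ε) : MemE q d φ := by
  refine ⟨ε, hε, hφ.diff, 1, one_pos, 1, one_pos, B, fun x hx _ => hφ.bound x hx,
    fun x hx _ => (mul_le_of_le_one_right (norm_nonneg _) ?_).trans (hφ.bound x hx)⟩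
  have hL := Real.log_pos hq
  rw [Real.exp_le_one_iff]
  exact div_nonpos_of_nonpos_of_nonneg (neg_nonpos.2 (sq_nonneg _)) (by positivity)

/-! ### Taylor remainders on a sector -/

/-- `R N` is the bounded holomorphic extension to a sector of the shifted series
`∑ i, β (N + i) ξ ^ i`, with geometric bounds in `N`. -/
structure TaylorFamily (d ε M K : ℝ) (β : ℕ → ℂ) (R : ℕ → ℂ → ℂ) : Prop where
  hol : ∀ N, BoundedHol d ε (M * K ^ N) (R N)
  coeff : ∀ N, ‖β N‖ ≤ M * K ^ N
  step : ∀ N, ∀ x ∈ sector d ε, R N x = β N + Complex.exp x * R (N + 1) x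

namespace TaylorFamily

variable {d ε M K : ℝ} {β : ℕ → ℂ} {R : ℕ → ℂ → ℂ}

theorem M_nonneg (h : TaylorFamily d ε M K β R) : 0 ≤ M := by
  simpa using (norm_nonneg _).trans (h.coeff 0)

theorem mono {ε' M' K' : ℝ} (h : TaylorFamily d ε M K β R) (hε : ε' ≤ ε) (hM : M ≤ M')
    (hK : 0 ≤ K) (hKK' : K ≤ K') : TaylorFamily d ε' M' K' β R := by
  have hle : ∀ N : ℕ, M * K ^ N ≤ M' * K' ^ N := fun N => by
    have := h.M_nonneg
    have := this.trans hM
    gcongr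
  exact ⟨fun N => ⟨(h.hol N).diff.mono (sector_mono hε),
      fun x hx => ((h.hol N).bound x (sector_mono hε hx)).trans (hle N)⟩,
    fun N => (h.coeff N).trans (hle N), fun N x hx => h.step N x (sector_mono hε hx)⟩

theorem const_mul (h : TaylorFamily d ε M K β R) (c : ℂ) :
    TaylorFamily d ε (‖c‖ * M) K (fun N => c * β N) (fun N x => c * R N x) where
  hol N := by simpa only [mul_assoc] using (h.hol N).const_mul c
  coeff N := by
    rw [norm_mul, mul_assoc]
    exact mul_le_mul_of_nonneg_left (h.coeff N) (norm_nonneg _)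
  step N x hx := by
    simp only [h.step N x hx]
    ring

/-- Division of the series by `a + ξ`. -/
theorem div_add {a : ℂ} {δ : ℝ} (h : TaylorFamily d ε M K β R) (hK : 1 ≤ K) (ha : a ≠ 0)
    (hδ : 0 < δ) (hdist : ∀ x ∈ sector d ε, δ ≤ ‖a + Complex.exp x‖) {g : ℕ → ℂ}
    (hg0 : a * g 0 = β 0) (hg : ∀ N, a * g (N + 1) + g N = β (N + 1)) :
    ∃ M' K' : ℝ, 1 ≤ K' ∧ ∃ R', TaylorFamily d ε M' K' g R' := by
  have hM := h.M_nonneg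
  have ha' : 0 < ‖a‖ := norm_pos_iff.2 ha
  -- This choice closes the recursion for g with constant M₁ = 2M/‖a‖: each of the two terms
  -- bounding ‖a‖ ‖g (N + 1)‖ is at most half of the target.
  set K' := max K (2 / ‖a‖) with hK'
  have hKK' : K ≤ K' := le_max_left _ _
  have hK'1 : 1 ≤ K' := hK.trans hKK'
  have hK'0 : 0 ≤ K' := zero_le_one.trans hK'1
  have hpow : ∀ N : ℕ, K ^ N ≤ K' ^ N := fun N => pow_le_pow_left₀ (zero_le_one.trans hK) hKK' N
  set M₁ := 2 * M / ‖a‖ with hM₁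
  have hM₁0 : 0 ≤ M₁ := by positivity
  have hgb : ∀ N, ‖g N‖ ≤ M₁ * K' ^ N := by
    intro N
    induction N with
    | zero =>
      have h0 : ‖a‖ * ‖g 0‖ ≤ M := by
        rw [← norm_mul, hg0]; simpa using h.coeff 0
      rw [hM₁, pow_zero, mul_one, le_div_iff₀ ha']
      linarith
    | succ N ih =>
      have h0 : ‖a‖ * ‖g (N + 1)‖ ≤ M * K' ^ (N + 1) + M₁ * K' ^ N := by
        rw [← norm_mul, eq_sub_of_add_eq (hg N)]
        refine (norm_sub_le _ _).trans (add_le_add ((h.coeff _).trans ?_) ih)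
        exact mul_le_mul_of_nonneg_left (hpow _) hM
      have h1 : 2 ≤ K' * ‖a‖ := (div_le_iff₀ ha').1 (le_max_right _ _)
      have h2 : M * K' ^ (N + 1) = ‖a‖ * (M₁ / 2 * K' ^ (N + 1)) := by
        rw [hM₁]; field_simp
      have h3 : M₁ * K' ^ N ≤ ‖a‖ * (M₁ / 2 * K' ^ (N + 1)) := by
        have : 0 ≤ M₁ * K' ^ N := by positivity
        calc M₁ * K' ^ N ≤ M₁ * K' ^ N * (K' * ‖a‖ / 2) := le_mul_of_one_le_right this (by linarith)
          _ = _ := by ring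
      have h4 : ‖a‖ * ‖g (N + 1)‖ ≤ ‖a‖ * (M₁ * K' ^ (N + 1)) := by
        calc _ ≤ _ := h0
          _ ≤ ‖a‖ * (M₁ / 2 * K' ^ (N + 1)) + ‖a‖ * (M₁ / 2 * K' ^ (N + 1)) := by
            rw [h2]; gcongr
          _ = _ := by ring
      exact le_of_mul_le_mul_left h4 ha'
  have hne : ∀ x ∈ sector d ε, a + Complex.exp x ≠ 0 := fun x hx h0 => by
    have := hdist x hx
    rw [h0, norm_zero] at this
    linarith
  -- The sequence g delayed by one, with p 0 = 0. Multiplying the N-th remainder of the quotient by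
  -- a + ξ gives R N minus g (N - 1), so that remainder is (R N - p N) / (a + ξ).
  set p : ℕ → ℂ := fun N => match N with
    | 0 => 0
    | N + 1 => g N
  have hp : ∀ N, ‖p N‖ ≤ M₁ * K' ^ N := by
    intro N
    cases N with
    | zero => simpa [p] using hM₁0
    | succ N =>
      refine (hgb N).trans (mul_le_mul_of_nonneg_left ?_ hM₁0)
      exact pow_le_pow_right₀ hK'1 (Nat.le_succ N)
  have hrel : ∀ N, a * g N + p N = β N := by
    intro N
    cases N with
    | zero => simpa [p] using hg0
    | succ N => exact hg N
  refine ⟨M₁ + (M + M₁) / δ, K', hK'1, fun N x => (R N x - p N) / (a + Complex.exp x),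
    ⟨fun N => ⟨?_, fun x hx => ?_⟩, fun N => (hgb N).trans ?_, fun N x hx => ?_⟩⟩
  · exact ((h.hol N).diff.sub_const _).div (by fun_prop) hne
  · have hnum : ‖R N x - p N‖ ≤ (M + M₁) * K' ^ N := by
      refine (norm_sub_le _ _).trans ?_
      rw [add_mul]
      exact add_le_add (((h.hol N).bound x hx).trans (mul_le_mul_of_nonneg_left (hpow N) hM)) (hp N)
    calc ‖(R N x - p N) / (a + Complex.exp x)‖ ≤ (M + M₁) * K' ^ N / δ := by
          rw [norm_div]
          exact div_le_div₀ (by positivity) hnum hδ (hdist x hx)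
      _ ≤ M₁ * K' ^ N + (M + M₁) * K' ^ N / δ := le_add_of_nonneg_left (by positivity)
      _ = _ := by ring
  · have : 0 ≤ (M + M₁) / δ := by positivity
    gcongr
    linarith
  · have h0 := hne x hx
    have h1 := hrel N
    simp only [h.step N x hx, p]
    rw [div_eq_iff h0, add_mul, mul_assoc, div_mul_cancel₀ _ h0]
    linear_combination (-1 : ℂ) * h1

end TaylorFamily

/-- The coefficients of `(a + ξ) ^ (-(m + 1))`. -/
noncomputable def invPowCoeff (a : ℂ) (m j : ℕ) : ℂ :=
  ((j + m).choose m : ℂ) * (-1) ^ j * (a ^ (j + m + 1))⁻¹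

/-- Repeated division by a + ξ, starting from the constant series 1. The recursion between the
coefficients for consecutive m is Pascal's rule. -/
theorem exists_taylorFamily_invPow {d ε δ : ℝ} {a : ℂ} (ha : a ≠ 0) (hδ : 0 < δ)
    (hdist : ∀ x ∈ sector d ε, δ ≤ ‖a + Complex.exp x‖) (m : ℕ) :
    ∃ M K : ℝ, 1 ≤ K ∧ ∃ R, TaylorFamily d ε M K (invPowCoeff a m) R := by
  induction m with
  | zero =>
    have h : TaylorFamily d ε 1 1 (fun N => if N = 0 then 1 else 0)
        (fun N _ => if N = 0 then 1 else 0) := by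
      refine ⟨fun N => ⟨by fun_prop, fun x _ => ?_⟩, fun N => ?_, fun N x _ => ?_⟩
      · split_ifs <;> simp
      · split_ifs <;> simp
      · simp
    obtain ⟨M, K, hK, R, hR⟩ := h.div_add (g := invPowCoeff a 0) le_rfl ha hδ hdist
      (by simp [invPowCoeff, ha]) (fun N => by
        simp only [invPowCoeff, Nat.choose_zero_right, add_zero, Nat.cast_one, one_mul,
          Nat.succ_ne_zero, if_false]
        field_simp
        ring)
    exact ⟨M, K, hK, R, hR⟩
  | succ m ih =>
    obtain ⟨M, K, hK, R, hR⟩ := ih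
    obtain ⟨M', K', hK', R', hR'⟩ := hR.div_add (g := invPowCoeff a (m + 1)) hK ha hδ hdist
      (by
        simp only [invPowCoeff, zero_add, Nat.choose_self, Nat.cast_one, pow_zero, mul_one, one_mul]
        field_simp
        ring)
      (fun N => by
        have hc : ((N + 1 + (m + 1)).choose (m + 1) : ℂ) =
            (N + 1 + m).choose m + (N + (m + 1)).choose (m + 1) := by
          rw [show N + 1 + (m + 1) = (N + 1 + m) + 1 by ring, Nat.choose_succ_succ,
            show N + (m + 1) = N + 1 + m by ring]
          push_cast
          rfl
        simp only [invPowCoeff, hc]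
        rw [show N + 1 + (m + 1) + 1 = (N + 1 + m + 1) + 1 by ring,
          show N + (m + 1) + 1 = N + 1 + m + 1 by ring, pow_succ a (N + 1 + m + 1)]
        field_simp
        ring)
    exact ⟨M', K', hK', R', hR'⟩

/-! ### Distance to the pole -/

/-- With r = exp (re z) and c = cos (im z), the quantity 1 - 2rc + r² is at least 1 - c² if c ≥ 0
and at least 1 otherwise. Independence of re z makes the bound uniform along a sector. -/
theorem norm_one_sub_exp_sq_ge (z : ℂ) :
    (1 - Real.cos z.im) / 2 ≤ ‖1 - Complex.exp z‖ ^ 2 := by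
  rw [← Complex.normSq_eq_norm_sq, Complex.normSq_apply]
  simp only [Complex.sub_re, Complex.one_re, Complex.sub_im, Complex.one_im, Complex.exp_re,
    Complex.exp_im]
  have h1 := Real.sin_sq_add_cos_sq z.im
  have h2 := Real.exp_pos z.re
  have h3 := Real.cos_le_one z.im
  have h4 := Real.neg_one_le_cos z.im
  set r := Real.exp z.re
  set c := Real.cos z.im
  set t := Real.sin z.im
  have : (1 - r * c) * (1 - r * c) + (0 - r * t) * (0 - r * t) = 1 - 2 * r * c + r ^ 2 := by
    linear_combination r ^ 2 * h1
  rw [this]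
  rcases le_total 0 c with hc | hc
  · nlinarith [sq_nonneg (r - c)]
  · nlinarith [mul_nonneg h2.le (neg_nonneg.2 hc), sq_nonneg r]

theorem exists_dist_le_norm_add_exp {a : ℂ} (ha : a ≠ 0) {d : ℝ}
    (hd : ∀ k : ℤ, d ≠ Complex.arg (-a) + 2 * Real.pi * (k : ℝ)) :
    ∃ ε : ℝ, 0 < ε ∧ ∃ δ : ℝ, 0 < δ ∧ ∀ x ∈ sector d ε, δ ≤ ‖a + Complex.exp x‖ := by
  set θ := Complex.arg (-a)
  have hpos : 0 < 1 - Real.cos (d - θ) := by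
    refine sub_pos.2 (lt_of_le_of_ne (Real.cos_le_one _) fun h => ?_)
    obtain ⟨k, hk⟩ := (Real.cos_eq_one_iff _).1 h
    exact hd k (by linarith)
  have hcont : Continuous fun y : ℝ => 1 - Real.cos (y - θ) := by fun_prop
  obtain ⟨ε, hε, hball⟩ := Metric.eventually_nhds_iff.1
    (hcont.continuousAt.eventually (lt_mem_nhds (half_lt_self hpos)))
  -- One factor 1/2 is lost when the argument moves from d to a nearby one, the other comes from
  -- `norm_one_sub_exp_sq_ge`.
  refine ⟨ε, hε, ‖a‖ * Real.sqrt ((1 - Real.cos (d - θ)) / 2 / 2), ?_, fun x hx => ?_⟩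
  · have := norm_pos_iff.2 ha
    positivity
  · have hna : -a ≠ 0 := neg_ne_zero.2 ha
    have h1 : a + Complex.exp x = a * (1 - Complex.exp (x - Complex.log (-a))) := by
      rw [Complex.exp_sub, Complex.exp_log hna]
      field_simp
      ring
    rw [h1, norm_mul]
    refine mul_le_mul_of_nonneg_left (Real.sqrt_le_iff.2 ⟨norm_nonneg _, ?_⟩) (norm_nonneg _)
    refine le_trans ?_ (norm_one_sub_exp_sq_ge _)
    have h2 := hball (y := x.im) (by rw [Real.dist_eq]; exact hx)
    simp only [Complex.sub_im, Complex.log_im]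
    simp only [θ] at h2 ⊢
    linarith

/-! ### Gaussian-weighted series of bounded functions -/

theorem mul_sub_sq_le (c N : ℝ) {L : ℝ} (hL : 0 < L) : c * N - L * N ^ 2 ≤ c ^ 2 / (4 * L) := by
  rw [le_div_iff₀ (by positivity)]
  nlinarith [sq_nonneg (c - 2 * L * N)]

/-- Completing the square with c + 1 in place of c leaves a summable e^(-N) independent of c; this
gives growth bounds for Gaussian-weighted sums. -/
theorem exp_mul_sub_sq_le (c : ℝ) (N : ℕ) {L : ℝ} (hL : 0 < L) :
    Real.exp (c * N - L * (N : ℝ) ^ 2) ≤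
      Real.exp ((c + 1) ^ 2 / (4 * L)) * Real.exp (-(N : ℝ)) := by
  rw [← Real.exp_add, Real.exp_le_exp]
  linarith [mul_sub_sq_le (c + 1) N hL]

theorem summable_exp_mul_sub_sq (c : ℝ) {L : ℝ} (hL : 0 < L) :
    Summable fun N : ℕ => Real.exp (c * N - L * (N : ℝ) ^ 2) :=
  Summable.of_nonneg_of_le (fun _ => Real.exp_nonneg _) (fun N => exp_mul_sub_sq_le c N hL)
    (Real.summable_exp_neg_nat.mul_left _)

/-- The `N`-th term `q ^ (-N²) ξ ^ (2 N) H N (ξ / q ^ N)`, where `L = log q`. -/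
noncomputable def gaussTerm (L : ℝ) (H : ℕ → ℂ → ℂ) (N : ℕ) (x : ℂ) : ℂ :=
  Complex.exp (2 * N * x - N ^ 2 * L) * H N (x - (N * L : ℝ))

/-- The series `∑ N, q ^ (-N²) ξ ^ (2 N) H N (ξ / q ^ N)`, where `L = log q`. -/
noncomputable def gaussSeries (L : ℝ) (H : ℕ → ℂ → ℂ) (x : ℂ) : ℂ :=
  ∑' N, gaussTerm L H N x

theorem norm_cexp_two_mul (L : ℝ) (N : ℕ) (x : ℂ) :
    ‖Complex.exp (2 * N * x - N ^ 2 * L)‖ = Real.exp (2 * x.re * N - L * (N : ℝ) ^ 2) := by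
  rw [Complex.norm_exp]
  congr 1
  have h : (2 * N * x - N ^ 2 * L : ℂ) = ((2 * N : ℝ) : ℂ) * x - ((N ^ 2 * L : ℝ) : ℂ) := by
    push_cast; ring
  rw [h, Complex.sub_re, Complex.re_ofReal_mul, Complex.ofReal_re]
  ring

section GaussSeries

variable {L d ε B κ : ℝ} {H : ℕ → ℂ → ℂ}

theorem norm_gaussTerm_le (hH : ∀ N, BoundedHol d ε (B * Real.exp κ ^ N) (H N)) {x : ℂ}
    (hx : x ∈ sector d ε) (N : ℕ) :
    ‖gaussTerm L H N x‖ ≤ B * Real.exp ((2 * x.re + κ) * N - L * (N : ℝ) ^ 2) := by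
  rw [gaussTerm, norm_mul, norm_cexp_two_mul]
  refine (mul_le_mul_of_nonneg_left ((hH N).bound _ (sub_ofReal_mem_sector hx _))
    (Real.exp_nonneg _)).trans (le_of_eq ?_)
  rw [mul_left_comm, ← Real.exp_nat_mul, ← Real.exp_add]
  congr 2
  ring

theorem summable_gaussTerm (hL : 0 < L) (hH : ∀ N, BoundedHol d ε (B * Real.exp κ ^ N) (H N))
    {x : ℂ} (hx : x ∈ sector d ε) : Summable fun N => gaussTerm L H N x :=
  Summable.of_norm_bounded ((summable_exp_mul_sub_sq _ hL).mul_left B)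
    (norm_gaussTerm_le hH hx)

theorem differentiableOn_gaussSeries (hL : 0 < L) (hε : 0 < ε)
    (hH : ∀ N, BoundedHol d ε (B * Real.exp κ ^ N) (H N)) :
    DifferentiableOn ℂ (gaussSeries L H) (sector d ε) := by
  have hB : 0 ≤ B := by simpa using (hH 0).nonneg hε
  intro x₀ hx₀
  -- The Weierstrass test is uniform only where the modulus is bounded above, which suffices
  -- locally.
  have hopen : IsOpen (sector d ε ∩ {x : ℂ | x.re < x₀.re + 1}) :=
    (isOpen_sector d ε).inter (isOpen_lt Complex.continuous_re continuous_const)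
  have hD : DifferentiableOn ℂ (gaussSeries L H) (sector d ε ∩ {x : ℂ | x.re < x₀.re + 1}) := by
    refine Complex.differentiableOn_tsum_of_summable_norm (u := fun N : ℕ =>
      B * Real.exp ((2 * (x₀.re + 1) + κ) * N - L * (N : ℝ) ^ 2))
      ((summable_exp_mul_sub_sq _ hL).mul_left B) (fun N => ?_) hopen fun N x hx => ?_
    · refine DifferentiableOn.mul (by fun_prop) ((hH N).diff.comp (by fun_prop) fun x hx => ?_)
      exact sub_ofReal_mem_sector hx.1 _
    · refine (norm_gaussTerm_le hH hx.1 N).trans ?_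
      have : x.re ≤ x₀.re + 1 := le_of_lt hx.2
      gcongr
  exact (hD.differentiableAt (hopen.mem_nhds ⟨hx₀, by simp⟩)).differentiableWithinAt

theorem norm_gaussSeries_le (hL : 0 < L) (hε : 0 < ε)
    (hH : ∀ N, BoundedHol d ε (B * Real.exp κ ^ N) (H N)) {x : ℂ} (hx : x ∈ sector d ε) :
    ‖gaussSeries L H x‖ ≤
      B * (∑' N : ℕ, Real.exp (-(N : ℝ))) * Real.exp ((2 * x.re + κ + 1) ^ 2 / (4 * L)) := by
  have hB : 0 ≤ B := by simpa using (hH 0).nonneg hε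
  have h := tsum_of_norm_bounded ((Real.summable_exp_neg_nat.hasSum.mul_left
    (B * Real.exp ((2 * x.re + κ + 1) ^ 2 / (4 * L)))))
    (fun N => (norm_gaussTerm_le (L := L) hH hx N).trans ?_)
  · refine h.trans (le_of_eq ?_)
    ring
  · rw [mul_assoc]
    exact mul_le_mul_of_nonneg_left (exp_mul_sub_sq_le _ N hL) hB

theorem norm_gaussSeries_le_of_re_nonpos (hL : 0 < L) (hε : 0 < ε)
    (hH : ∀ N, BoundedHol d ε (B * Real.exp κ ^ N) (H N)) {x : ℂ} (hx : x ∈ sector d ε)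
    (hre : x.re ≤ 0) :
    ‖gaussSeries L H x‖ ≤ B * ∑' N : ℕ, Real.exp (κ * N - L * (N : ℝ) ^ 2) := by
  have hB : 0 ≤ B := by simpa using (hH 0).nonneg hε
  refine tsum_of_norm_bounded ((summable_exp_mul_sub_sq κ hL).hasSum.mul_left B)
    fun N => (norm_gaussTerm_le (L := L) hH hx N).trans ?_
  gcongr
  linarith

theorem memE_gaussSeries {p : ℝ} (hL : 0 < L) (hp : 2 * Real.log p = L) (hε : 0 < ε)
    (hH : ∀ N, BoundedHol d ε (B * Real.exp κ ^ N) (H N)) : MemE p d (gaussSeries L H) := by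
  set C₁ := B * ∑' N : ℕ, Real.exp (κ * N - L * (N : ℝ) ^ 2)
  set C₂ := B * ∑' N : ℕ, Real.exp (-(N : ℝ))
  -- With A = e^((κ+1)/2), (log (A|ξ|))²/(2 log p) is exactly the exponent in `norm_gaussSeries_le`,
  -- so the two exponentials cancel.
  refine ⟨ε, hε, differentiableOn_gaussSeries hL hε hH, Real.exp ((κ + 1) / 2), Real.exp_pos _, 1,
    one_pos, max C₁ C₂, fun x hx h1 => ?_, fun x hx _ => ?_⟩
  · refine (norm_gaussSeries_le_of_re_nonpos hL hε hH hx ?_).trans (le_max_left _ _)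
    rwa [modulus, Real.exp_le_one_iff] at h1
  · refine le_trans ?_ (le_max_right _ _)
    refine (mul_le_mul_of_nonneg_right (norm_gaussSeries_le hL hε hH hx)
      (Real.exp_nonneg _)).trans (le_of_eq ?_)
    rw [mul_assoc, ← Real.exp_add, modulus, ← Real.exp_add, Real.log_exp, hp]
    have : (2 * x.re + κ + 1) ^ 2 / (4 * L) + -((κ + 1) / 2 + x.re) ^ 2 / L = 0 := by
      field_simp
      ring
    rw [this, Real.exp_zero, mul_one]

/-- Completing the square, the kernel times e^(2Nξ - N²L), with ξ on the ray, is e^(2Ny) times the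
kernel translated by NL. This translation undoes the shift in H N. The integrals of the norms are
then dominated by a geometric series of ratio e^(2 re y + κ), which justifies termwise integration.
-/
theorem rayConv_gaussSeries (hL : 0 < L) (hε : 0 < ε)
    (hH : ∀ N, BoundedHol d ε (B * Real.exp κ ^ N) (H N)) {y : ℂ} (hy : 2 * y.re + κ < 0) :
    HasSum (fun N : ℕ => Complex.exp (2 * y) ^ N * rayConv L d (H N) y)
      (rayConv L d (gaussSeries L H) y) := by
  have hLc : (L : ℂ) ≠ 0 := by exact_mod_cast hL.ne'
  have hB : 0 ≤ B := by simpa using (hH 0).nonneg hε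
  set T : ℕ → ℝ → ℂ := fun N s => Complex.exp (-(y - rayPoint d s) ^ 2 / L) * H N (rayPoint d s)
  have hT : ∀ (N : ℕ) (s : ℝ), Complex.exp (-(y - rayPoint d s) ^ 2 / L) *
      gaussTerm L H N (rayPoint d s) = Complex.exp (2 * y) ^ N * T N (s - N * L) := by
    intro N s
    have h1 : rayPoint d s - ((N * L : ℝ) : ℂ) = rayPoint d (s - N * L) := by
      simp only [rayPoint]; push_cast; ring
    have h2 : Complex.exp (-(y - rayPoint d s) ^ 2 / L) *
        Complex.exp (2 * N * rayPoint d s - N ^ 2 * L) =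
        Complex.exp (2 * y) ^ N * Complex.exp (-(y - rayPoint d (s - N * L)) ^ 2 / L) := by
      rw [← Complex.exp_nat_mul, ← Complex.exp_add, ← Complex.exp_add, ← h1]
      congr 1
      push_cast
      field_simp
      ring
    simp only [gaussTerm, T]
    rw [h1, ← mul_assoc, h2, mul_assoc]
  have hTi : ∀ N, Integrable (T N) := fun N => (hH N).integrable_kernel hL hε y
  have hint : ∀ N : ℕ, Integrable fun s : ℝ => Complex.exp (2 * y) ^ N * T N (s - N * L) :=
    fun N => ((hTi N).comp_sub_right (N * L)).const_mul _
  have hsum : Summable fun N : ℕ => ∫ s : ℝ, ‖Complex.exp (2 * y) ^ N * T N (s - N * L)‖ := by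
    set C := Real.exp ((y.im - d) ^ 2 / L) * (∫ t : ℝ, Real.exp (-t ^ 2 / L)) * B
    have hg : Summable fun N : ℕ => C * Real.exp (2 * y.re + κ) ^ N :=
      (summable_geometric_of_lt_one (Real.exp_nonneg _) (Real.exp_lt_one_iff.2 hy)).mul_left C
    refine Summable.of_nonneg_of_le (fun N => integral_nonneg fun s => norm_nonneg _)
      (fun N => ?_) hg
    simp only [norm_mul, norm_pow]
    rw [integral_const_mul, integral_sub_right_eq_self (fun s : ℝ => ‖T N s‖) (N * L),
      Complex.norm_exp]
    have h1 := (hH N).integral_norm_kernel_le hL hε y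
    refine (mul_le_mul_of_nonneg_left h1 (by positivity)).trans (le_of_eq ?_)
    rw [Real.exp_add, mul_pow]
    simp only [C, Complex.mul_re, Complex.re_ofNat, Complex.im_ofNat, zero_mul, sub_zero]
    ring
  have hmain := hasSum_integral_of_summable_integral_norm hint hsum
  have h3 : ∀ N : ℕ, ∫ s : ℝ, Complex.exp (2 * y) ^ N * T N (s - N * L) =
      Complex.exp (2 * y) ^ N * rayConv L d (H N) y := fun N => by
    rw [integral_const_mul, integral_sub_right_eq_self (T N) (N * L)]
    rfl
  simp only [h3] at hmain
  have h4 : rayConv L d (gaussSeries L H) y =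
      ∫ s : ℝ, ∑' N : ℕ, Complex.exp (2 * y) ^ N * T N (s - N * L) := by
    refine integral_congr_ae (Eventually.of_forall fun s => ?_)
    simp only [← hT, gaussSeries]
    rw [tsum_mul_left]
  rwa [h4]

end GaussSeries

/-! ### The product of two Taylor families -/

/-- The part of the double series `∑ β (N + j) γ (N + k) ξʲ ηᵏ` on which `j` or `k` vanishes, in
terms of the remainders, at `ξ = η`. -/
def crossTerm (β γ : ℕ → ℂ) (R Q : ℕ → ℂ → ℂ) (N : ℕ) (x : ℂ) : ℂ :=
  γ N * R N x + β N * Q N x - β N * γ N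

section Product

variable {L d ε M κ : ℝ} {β γ : ℕ → ℂ} {R Q : ℕ → ℂ → ℂ}

theorem TaylorFamily.crossTerm_hol (hR : TaylorFamily d ε M (Real.exp κ) β R)
    (hQ : TaylorFamily d ε M (Real.exp κ) γ Q) (N : ℕ) :
    BoundedHol d ε (3 * M ^ 2 * Real.exp (2 * κ) ^ N) (crossTerm β γ R Q N) where
  diff := (((hR.hol N).diff.const_mul _).add ((hQ.hol N).diff.const_mul _)).sub_const _
  bound x hx := by
    have hM := hR.M_nonneg
    have h1 : 0 ≤ M * Real.exp κ ^ N := by positivity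
    have h2 : 3 * M ^ 2 * Real.exp (2 * κ) ^ N =
        M * Real.exp κ ^ N * (M * Real.exp κ ^ N) + M * Real.exp κ ^ N * (M * Real.exp κ ^ N) +
          M * Real.exp κ ^ N * (M * Real.exp κ ^ N) := by
      rw [show 2 * κ = κ + κ by ring, Real.exp_add, mul_pow]
      ring
    rw [crossTerm, h2]
    refine (norm_sub_le _ _).trans (add_le_add ((norm_add_le _ _).trans (add_le_add ?_ ?_)) ?_)
    · rw [norm_mul]
      exact mul_le_mul (hQ.coeff N) ((hR.hol N).bound x hx) (norm_nonneg _) h1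
    · rw [norm_mul]
      exact mul_le_mul (hR.coeff N) ((hQ.hol N).bound x hx) (norm_nonneg _) h1
    · rw [norm_mul]
      exact mul_le_mul (hR.coeff N) (hQ.coeff N) (norm_nonneg _) h1

/-! ### The Laplace transform of the convolution series -/

theorem integral_linear_combination {f g h k : ℝ → ℂ} (hf : Integrable f) (hg : Integrable g)
    (hh : Integrable h) (hk : Integrable k) (a b c e : ℂ) :
    ∫ t, (a * f t + b * g t - c * h t + e * k t) =
      a * (∫ t, f t) + b * (∫ t, g t) - c * (∫ t, h t) + e * ∫ t, k t := by
  have h1 : Integrable fun t => a * f t + b * g t := (hf.const_mul a).add (hg.const_mul b)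
  have h2 : Integrable fun t => a * f t + b * g t - c * h t := h1.sub (hh.const_mul c)
  rw [integral_add h2 (hk.const_mul e), integral_sub h1 (hh.const_mul c),
    integral_add (hf.const_mul a) (hg.const_mul b)]
  simp only [integral_const_mul]

/-- Expand (R N - β N)(Q N - γ N) at the points y + t and y - t: the exponentials multiply to
e^(2y), free of t, and the remaining terms form the cross term, whose Gaussian mean is moved to the
ray. -/
theorem TaylorFamily.gaussCorr_step (hR : TaylorFamily d ε M (Real.exp κ) β R)
    (hQ : TaylorFamily d ε M (Real.exp κ) γ Q) (hL : 0 < L) (hε : 0 < ε) {y : ℂ}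
    (hy : y ∈ sector d ε) (N : ℕ) :
    gaussCorr L (R N) (Q N) y = rayConv L d (crossTerm β γ R Q N) y +
      Complex.exp (2 * y) * gaussCorr L (R (N + 1)) (Q (N + 1)) y := by
  have hadd := fun t : ℝ => add_ofReal_mem_sector hy t
  have hsub := fun t : ℝ => sub_ofReal_mem_sector hy t
  have cRp : Continuous fun t : ℝ => R N (y + t) :=
    continuous_comp_sector (hR.hol N).diff (by fun_prop) hadd
  have cQp : Continuous fun t : ℝ => Q N (y + t) :=
    continuous_comp_sector (hQ.hol N).diff (by fun_prop) hadd
  have cQm : Continuous fun t : ℝ => Q N (y - t) :=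
    continuous_comp_sector (hQ.hol N).diff (by fun_prop) hsub
  have cprod : Continuous fun t : ℝ => R (N + 1) (y + t) * Q (N + 1) (y - t) :=
    (continuous_comp_sector (hR.hol _).diff (by fun_prop) hadd).mul
      (continuous_comp_sector (hQ.hol _).diff (by fun_prop) hsub)
  have i1 := integrable_gauss hL cRp fun t => (hR.hol N).bound _ (hadd t)
  have i2 := integrable_gauss hL cQp fun t => (hQ.hol N).bound _ (hadd t)
  have i3 := integrable_gauss hL cQm fun t => (hQ.hol N).bound _ (hsub t)
  have i4 := integrable_gauss hL cprod fun t => (hR.hol _).norm_mul_le (hQ.hol _) hε hy t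
  have i5 := integrable_gauss hL (g := fun _ => (1 : ℂ)) (B := 1) continuous_const (by simp)
  -- Evenness of the Gaussian brings Q to the same point y + t as R, as the one-variable `crossTerm`
  -- requires.
  have hrefl : ∫ t : ℝ, Complex.exp (-(t : ℂ) ^ 2 / L) * Q N (y - t) =
      ∫ t : ℝ, Complex.exp (-(t : ℂ) ^ 2 / L) * Q N (y + t) := by
    rw [← integral_neg_eq_self]
    simp
  have hray : rayConv L d (crossTerm β γ R Q N) y =
      γ N * (∫ t : ℝ, Complex.exp (-(t : ℂ) ^ 2 / L) * R N (y + t)) +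
        β N * (∫ t : ℝ, Complex.exp (-(t : ℂ) ^ 2 / L) * Q N (y + t)) -
        β N * γ N * ∫ t : ℝ, Complex.exp (-(t : ℂ) ^ 2 / L) * 1 := by
    have hlin := integral_linear_combination i1 i2 i5 i1 (γ N) (β N) (β N * γ N) 0
    rw [zero_mul, add_zero] at hlin
    rw [← (hR.crossTerm_hol hQ N).integral_gauss_eq_rayConv hL hε hy, ← hlin]
    refine integral_congr_ae (Eventually.of_forall fun t => ?_)
    simp only [crossTerm]
    ring
  rw [hray, ← hrefl, gaussCorr, gaussCorr, ← integral_linear_combination i1 i3 i5 i4]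
  refine integral_congr_ae (Eventually.of_forall fun t => ?_)
  have e1 := hR.step N _ (hadd t)
  have e2 := hQ.step N _ (hsub t)
  have e3 : Complex.exp (2 * y) = Complex.exp (y + t) * Complex.exp (y - t) := by
    rw [← Complex.exp_add]
    congr 1
    ring
  simp only [e1, e2, e3]
  ring

/-- Iterating `TaylorFamily.gaussCorr_step` yields the partial sums of `rayConv_gaussSeries`, with a
remainder O(e^(2I(re y + κ))) that tends to 0. This links the two functions of the tower of the
product. -/
theorem TaylorFamily.rayConv_gaussSeries_eq (hR : TaylorFamily d ε M (Real.exp κ) β R)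
    (hQ : TaylorFamily d ε M (Real.exp κ) γ Q) (hL : 0 < L) (hε : 0 < ε) {y : ℂ}
    (hy : y ∈ sector d ε) (hre : y.re + κ < 0) :
    rayConv L d (gaussSeries L (crossTerm β γ R Q)) y = gaussCorr L (R 0) (Q 0) y := by
  have hsum := rayConv_gaussSeries hL hε (hR.crossTerm_hol hQ) (y := y) (by linarith)
  have hpart : ∀ I : ℕ, gaussCorr L (R 0) (Q 0) y =
      (∑ N ∈ Finset.range I, Complex.exp (2 * y) ^ N * rayConv L d (crossTerm β γ R Q N) y) +
        Complex.exp (2 * y) ^ I * gaussCorr L (R I) (Q I) y := by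
    intro I
    induction I with
    | zero => simp
    | succ I ih =>
      rw [ih, hR.gaussCorr_step hQ hL hε hy I, Finset.sum_range_succ]
      ring
  have hrem : Tendsto (fun I : ℕ => Complex.exp (2 * y) ^ I * gaussCorr L (R I) (Q I) y) atTop
      (𝓝 0) := by
    set C := (∫ t : ℝ, Real.exp (-t ^ 2 / L)) * M ^ 2
    have hg : Tendsto (fun I : ℕ => C * Real.exp (2 * (y.re + κ)) ^ I) atTop (𝓝 0) := by
      simpa using (tendsto_pow_atTop_nhds_zero_of_lt_one (Real.exp_nonneg _)
        (Real.exp_lt_one_iff (x := 2 * (y.re + κ)) |>.2 (by linarith))).const_mul C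
    refine squeeze_zero_norm (fun I => ?_) hg
    rw [norm_mul, norm_pow, Complex.norm_exp]
    refine (mul_le_mul_of_nonneg_left (((hR.hol I).gaussCorr (hQ.hol I) hL hε).bound y hy)
      (by positivity)).trans (le_of_eq ?_)
    rw [show 2 * (y.re + κ) = 2 * y.re + (κ + κ) by ring, Real.exp_add, Real.exp_add, mul_pow,
      mul_pow]
    simp only [C, Complex.mul_re, Complex.re_ofNat, Complex.im_ofNat, zero_mul, sub_zero]
    ring
  have hlim := hsum.tendsto_sum_nat.add hrem
  simp only [← hpart, add_zero] at hlim
  exact tendsto_nhds_unique hlim tendsto_const_nhds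

/-! ### The sum of the Borel transform near the origin -/

/-- The relation `step` telescopes, and the geometric bounds kill the remainder when |ξ| < e^(-κ).
-/
theorem TaylorFamily.hasSum (hR : TaylorFamily d ε M (Real.exp κ) β R) {x : ℂ}
    (hx : x ∈ sector d ε) (hre : x.re + κ < 0) (N : ℕ) :
    HasSum (fun k => β (N + k) * Complex.exp x ^ k) (R N x) := by
  have hlt : Real.exp (x.re + κ) < 1 := Real.exp_lt_one_iff.2 hre
  have hnorm : ∀ k, ‖Complex.exp x‖ ^ k * (M * Real.exp κ ^ (N + k)) =
      M * Real.exp κ ^ N * Real.exp (x.re + κ) ^ k := fun k => by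
    rw [Complex.norm_exp, Real.exp_add, mul_pow, pow_add]
    ring
  have hgeo : Summable fun k : ℕ => M * Real.exp κ ^ N * Real.exp (x.re + κ) ^ k :=
    (summable_geometric_of_lt_one (Real.exp_nonneg _) hlt).mul_left _
  have hs : Summable fun k => β (N + k) * Complex.exp x ^ k := by
    refine Summable.of_norm_bounded hgeo fun k => ?_
    rw [norm_mul, norm_pow, mul_comm, ← hnorm]
    exact mul_le_mul_of_nonneg_left (hR.coeff _) (by positivity)
  have hpart : ∀ I : ℕ, R N x = (∑ k ∈ Finset.range I, β (N + k) * Complex.exp x ^ k) +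
      Complex.exp x ^ I * R (N + I) x := by
    intro I
    induction I with
    | zero => simp
    | succ I ih =>
      rw [ih, hR.step (N + I) x hx, Finset.sum_range_succ, ← add_assoc]
      ring
  have hrem : Tendsto (fun I : ℕ => Complex.exp x ^ I * R (N + I) x) atTop (𝓝 0) := by
    refine squeeze_zero_norm (fun I => ?_) hgeo.tendsto_atTop_zero
    rw [norm_mul, norm_pow, ← hnorm]
    exact mul_le_mul_of_nonneg_left ((hR.hol _).bound x hx) (by positivity)
  have hlim := hs.hasSum.tendsto_sum_nat.add hrem
  simp only [← hpart, add_zero] at hlim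
  have h := hs.hasSum
  rwa [tendsto_nhds_unique hlim tendsto_const_nhds] at h

/-- The shifted double series `∑ β (N + j) γ (N + k) q ^ (-j k) ξ ^ (j + k)`, summed over `k`. -/
noncomputable def mixedSeries (L : ℝ) (β : ℕ → ℂ) (Q : ℕ → ℂ → ℂ) (N : ℕ) (x : ℂ) : ℂ :=
  ∑' j : ℕ, β (N + j) * Complex.exp x ^ j * Q N (x - (j * L : ℝ))

theorem TaylorFamily.norm_mixed_le (hR : TaylorFamily d ε M (Real.exp κ) β R)
    (hQ : TaylorFamily d ε M (Real.exp κ) γ Q) {x : ℂ} (hx : x ∈ sector d ε) (N j : ℕ) :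
    ‖β (N + j) * Complex.exp x ^ j * Q N (x - (j * L : ℝ))‖ ≤
      M ^ 2 * Real.exp (2 * κ) ^ N * Real.exp (x.re + κ) ^ j := by
  have hM := hR.M_nonneg
  rw [norm_mul, norm_mul, norm_pow, Complex.norm_exp]
  refine (mul_le_mul (mul_le_mul_of_nonneg_right (hR.coeff _) (by positivity))
    ((hQ.hol N).bound _ (sub_ofReal_mem_sector hx _)) (norm_nonneg _)
    (by positivity)).trans (le_of_eq ?_)
  rw [show 2 * κ = κ + κ by ring, Real.exp_add, Real.exp_add, mul_pow, mul_pow, pow_add]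
  ring

theorem TaylorFamily.summable_mixed (hR : TaylorFamily d ε M (Real.exp κ) β R)
    (hQ : TaylorFamily d ε M (Real.exp κ) γ Q) {x : ℂ} (hx : x ∈ sector d ε)
    (hre : x.re + κ < 0) (N : ℕ) :
    Summable fun j : ℕ => β (N + j) * Complex.exp x ^ j * Q N (x - (j * L : ℝ)) :=
  Summable.of_norm_bounded ((summable_geometric_of_lt_one (Real.exp_nonneg _)
    (Real.exp_lt_one_iff.2 hre)).mul_left _) (hR.norm_mixed_le hQ hx N)

/-- Keep the term j = 0 and, for j ≥ 1, expand Q N (ξ/q^j) by one Taylor step. The constants γ N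
collect into γ N (R N - β N), completing the cross term; the rest is the next mixed series at ξ/q.
-/
theorem TaylorFamily.mixedSeries_step (hR : TaylorFamily d ε M (Real.exp κ) β R)
    (hQ : TaylorFamily d ε M (Real.exp κ) γ Q) (hL : 0 < L) {x : ℂ} (hx : x ∈ sector d ε)
    (hre : x.re + κ < 0) (N : ℕ) :
    mixedSeries L β Q N x = crossTerm β γ R Q N x +
      Complex.exp (2 * x - L) * mixedSeries L β Q (N + 1) (x - L) := by
  have h0 := (hR.summable_mixed (L := L) hQ hx hre N).tsum_eq_zero_add
  have hsumR := (hasSum_nat_add_iff' 1).2 (hR.hasSum hx hre N)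
  have hxL : x - (L : ℂ) ∈ sector d ε := sub_ofReal_mem_sector hx L
  have hreL : (x - (L : ℂ)).re + κ < 0 := by
    simp only [Complex.sub_re, Complex.ofReal_re]
    linarith
  have hsumW := (hR.summable_mixed (L := L) hQ hxL hreL (N + 1)).hasSum
  have hterm : ∀ j : ℕ, β (N + (j + 1)) * Complex.exp x ^ (j + 1) *
      Q N (x - ((j + 1 : ℕ) * L : ℝ)) = γ N * (β (N + (j + 1)) * Complex.exp x ^ (j + 1)) +
        Complex.exp (2 * x - L) * (β (N + 1 + j) * Complex.exp (x - L) ^ j *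
          Q (N + 1) (x - L - (j * L : ℝ))) := by
    intro j
    have e1 : x - (((j + 1 : ℕ) * L : ℝ) : ℂ) = x - L - (j * L : ℝ) := by push_cast; ring
    have e2 : Complex.exp x ^ (j + 1) * Complex.exp (x - L - (j * L : ℝ)) =
        Complex.exp (2 * x - L) * Complex.exp (x - L) ^ j := by
      rw [← Complex.exp_nat_mul, ← Complex.exp_nat_mul, ← Complex.exp_add, ← Complex.exp_add]
      congr 1
      push_cast
      ring
    rw [hQ.step N _ (sub_ofReal_mem_sector hx _), e1, show N + 1 + j = N + (j + 1) by ring]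
    linear_combination β (N + (j + 1)) * Q (N + 1) (x - L - (j * L : ℝ)) * e2
  simp only [hterm] at h0
  rw [((hsumR.mul_left (γ N)).add (hsumW.mul_left (Complex.exp (2 * x - L)))).tsum_eq] at h0
  rw [mixedSeries, h0, mixedSeries, crossTerm]
  simp
  ring

/-- Iterating the step sorts the double series by min(j, k): if j = N + j', k = N + k' and j'k' = 0,
then jk = N² + N(j' + k'). The remainder is killed by q^(-I²). -/
theorem TaylorFamily.mixedSeries_eq_gaussSeries (hR : TaylorFamily d ε M (Real.exp κ) β R)
    (hQ : TaylorFamily d ε M (Real.exp κ) γ Q) (hL : 0 < L) {x : ℂ} (hx : x ∈ sector d ε)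
    (hre : x.re + κ < 0) :
    mixedSeries L β Q 0 x = gaussSeries L (crossTerm β γ R Q) x := by
  have hmem : ∀ I : ℕ, x - ((I * L : ℝ) : ℂ) ∈ sector d ε := fun I => sub_ofReal_mem_sector hx _
  have hle : ∀ I : ℕ, (x - ((I * L : ℝ) : ℂ)).re + κ ≤ x.re + κ := fun I => by
    simp only [Complex.sub_re, Complex.ofReal_re]
    have : (0 : ℝ) ≤ I * L := by positivity
    linarith
  have hpart : ∀ I : ℕ, mixedSeries L β Q 0 x =
      (∑ N ∈ Finset.range I, gaussTerm L (crossTerm β γ R Q) N x) +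
        Complex.exp (2 * I * x - I ^ 2 * L) * mixedSeries L β Q I (x - (I * L : ℝ)) := by
    intro I
    induction I with
    | zero => simp
    | succ I ih =>
      have e1 : x - ((I * L : ℝ) : ℂ) - L = x - (((I + 1 : ℕ) * L : ℝ) : ℂ) := by push_cast; ring
      have e2 : Complex.exp (2 * I * x - I ^ 2 * L) *
          Complex.exp (2 * (x - ((I * L : ℝ) : ℂ)) - L) =
          Complex.exp (2 * (I + 1 : ℕ) * x - (I + 1 : ℕ) ^ 2 * L) := by
        rw [← Complex.exp_add]
        congr 1
        push_cast
        ring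
      rw [ih, hR.mixedSeries_step hQ hL (hmem I) ((hle I).trans_lt hre), Finset.sum_range_succ,
        gaussTerm, e1, ← e2]
      ring
  have hlt : Real.exp (x.re + κ) < 1 := Real.exp_lt_one_iff.2 hre
  set S := ∑' j : ℕ, Real.exp (x.re + κ) ^ j
  have hW : ∀ I : ℕ, ‖mixedSeries L β Q I (x - (I * L : ℝ))‖ ≤
      M ^ 2 * Real.exp (2 * κ) ^ I * S := fun I => by
    refine tsum_of_norm_bounded
      ((summable_geometric_of_lt_one (Real.exp_nonneg _) hlt).hasSum.mul_left _)
      fun j => (hR.norm_mixed_le hQ (hmem I) I j).trans ?_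
    have := hle I
    gcongr
  have hrem : Tendsto (fun I : ℕ => Complex.exp (2 * I * x - I ^ 2 * L) *
      mixedSeries L β Q I (x - (I * L : ℝ))) atTop (𝓝 0) := by
    have hg := (((summable_exp_mul_sub_sq (2 * x.re + 2 * κ) hL).mul_left
      (M ^ 2 * S)).tendsto_atTop_zero)
    refine squeeze_zero_norm (fun I => ?_) hg
    rw [norm_mul, norm_cexp_two_mul]
    refine (mul_le_mul_of_nonneg_left (hW I) (Real.exp_nonneg _)).trans (le_of_eq ?_)
    rw [show (2 * x.re + 2 * κ) * (I : ℝ) - L * (I : ℝ) ^ 2 =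
      2 * x.re * I - L * (I : ℝ) ^ 2 + I * (2 * κ) by ring, Real.exp_add, Real.exp_nat_mul]
    ring
  have hlim := (summable_gaussTerm hL (hR.crossTerm_hol hQ) hx).hasSum.tendsto_sum_nat.add hrem
  simp only [← hpart, add_zero] at hlim
  exact tendsto_nhds_unique tendsto_const_nhds hlim

/-- The coefficients of the Borel transform of order one of a product, in terms of those of the
Borel transforms of the factors. -/
noncomputable def borelConv (L : ℝ) (β γ : ℕ → ℂ) (N : ℕ) : ℂ :=
  ∑ jk ∈ Finset.HasAntidiagonal.antidiagonal N, β jk.1 * γ jk.2 * Complex.exp (-(jk.1 * jk.2 * L : ℝ))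

theorem norm_exp_neg_le_one (hL : 0 < L) (j k : ℕ) :
    ‖Complex.exp (-(j * k * L : ℝ))‖ ≤ 1 := by
  rw [← Complex.ofReal_neg, Complex.norm_exp, Complex.ofReal_re, Real.exp_le_one_iff]
  have : (0 : ℝ) ≤ j * k * L := by positivity
  linarith

theorem TaylorFamily.norm_borelConv_le (hR : TaylorFamily d ε M (Real.exp κ) β R)
    (hQ : TaylorFamily d ε M (Real.exp κ) γ Q) (hL : 0 < L) (N : ℕ) :
    ‖borelConv L β γ N‖ ≤ M ^ 2 * (2 * Real.exp κ) ^ N := by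
  have hM := hR.M_nonneg
  have h1 : ∀ jk ∈ Finset.HasAntidiagonal.antidiagonal N,
      ‖β jk.1 * γ jk.2 * Complex.exp (-(jk.1 * jk.2 * L : ℝ))‖ ≤ M ^ 2 * Real.exp κ ^ N := by
    rintro ⟨j, k⟩ hjk
    rw [Finset.HasAntidiagonal.mem_antidiagonal] at hjk
    rw [norm_mul, norm_mul, ← hjk, pow_add]
    refine (mul_le_of_le_one_right (by positivity) (norm_exp_neg_le_one hL j k)).trans
      ((mul_le_mul (hR.coeff j) (hQ.coeff k) (norm_nonneg _) (by positivity)).trans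
        (le_of_eq (by ring)))
  refine (norm_sum_le_of_le _ h1).trans ?_
  rw [Finset.sum_const, Finset.Nat.card_antidiagonal, nsmul_eq_mul, mul_pow]
  have h2 : ((N + 1 : ℕ) : ℝ) ≤ 2 ^ N := by exact_mod_cast Nat.lt_two_pow_self
  calc ((N + 1 : ℕ) : ℝ) * (M ^ 2 * Real.exp κ ^ N) ≤ 2 ^ N * (M ^ 2 * Real.exp κ ^ N) := by gcongr
    _ = _ := by ring

/-- The double series converges absolutely, so antidiagonals may be exchanged for rows; as q^(-jk)
ξ^k = (ξ/q^j)^k, row j sums to a value of Q 0 at ξ/q^j. -/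
theorem TaylorFamily.tsum_borelConv (hR : TaylorFamily d ε M (Real.exp κ) β R)
    (hQ : TaylorFamily d ε M (Real.exp κ) γ Q) (hL : 0 < L) {x : ℂ} (hx : x ∈ sector d ε)
    (hre : x.re + κ < 0) :
    ∑' N : ℕ, borelConv L β γ N * Complex.exp x ^ N = mixedSeries L β Q 0 x := by
  have hM := hR.M_nonneg
  have hlt : Real.exp (x.re + κ) < 1 := Real.exp_lt_one_iff.2 hre
  set f : ℕ × ℕ → ℂ := fun jk => β jk.1 * γ jk.2 * Complex.exp (-(jk.1 * jk.2 * L : ℝ)) *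
    Complex.exp x ^ (jk.1 + jk.2)
  have hgeo := summable_geometric_of_lt_one (Real.exp_nonneg (x.re + κ)) hlt
  have hf : Summable f := by
    refine Summable.of_norm_bounded ((hgeo.mul_of_nonneg hgeo (fun _ => by positivity)
      (fun _ => by positivity)).mul_left (M ^ 2)) fun jk => ?_
    obtain ⟨j, k⟩ := jk
    simp only [f]
    rw [norm_mul, norm_mul, norm_mul, norm_pow, Complex.norm_exp x, pow_add, Real.exp_add]
    calc _ ≤ M * Real.exp κ ^ j * (M * Real.exp κ ^ k) * 1 *
          (Real.exp x.re ^ j * Real.exp x.re ^ k) := by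
          gcongr
          · exact hR.coeff j
          · exact hQ.coeff k
          · exact norm_exp_neg_le_one hL j k
      _ = _ := by ring
  have h1 : ∑' jk, f jk = mixedSeries L β Q 0 x := by
    rw [hf.tsum_prod, mixedSeries]
    refine tsum_congr fun j => ?_
    have hre' : (x - ((j * L : ℝ) : ℂ)).re + κ < 0 := by
      simp only [Complex.sub_re, Complex.ofReal_re]
      have : (0 : ℝ) ≤ j * L := by positivity
      linarith
    rw [← (hQ.hasSum (sub_ofReal_mem_sector hx _) hre' 0).tsum_eq, ← tsum_mul_left]
    refine tsum_congr fun k => ?_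
    have e : Complex.exp (-(j * k * L : ℝ)) * Complex.exp x ^ (j + k) =
        Complex.exp x ^ j * Complex.exp (x - (j * L : ℝ)) ^ k := by
      rw [← Complex.exp_nat_mul, ← Complex.exp_nat_mul, ← Complex.exp_nat_mul, ← Complex.exp_add,
        ← Complex.exp_add]
      congr 1
      push_cast
      ring
    simp only [f, zero_add]
    linear_combination β j * γ k * e
  have hσ : Summable (f ∘ Finset.HasAntidiagonal.sigmaAntidiagonalEquivProd) :=
    Finset.HasAntidiagonal.sigmaAntidiagonalEquivProd.summable_iff.2 hf
  rw [← h1, ← Finset.HasAntidiagonal.sigmaAntidiagonalEquivProd.tsum_eq f]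
  refine Eq.trans ?_ (hσ.tsum_sigma' fun N => (hasSum_fintype _).summable).symm
  refine tsum_congr fun N => ?_
  rw [tsum_fintype, borelConv, Finset.sum_mul, ← Finset.sum_coe_sort]
  refine Finset.sum_congr rfl fun jk _ => ?_
  have h := Finset.HasAntidiagonal.mem_antidiagonal.1 jk.2
  simp only [f, Function.comp, Finset.HasAntidiagonal.sigmaAntidiagonalEquivProd_apply, h]

end Product

/-! ### Orders and Borel transforms -/

theorem qRoot_one (q : ℝ) : qRoot q 1 = q := by simp [qRoot]

theorem one_lt_qRoot_two {q : ℝ} (hq : 1 < q) : 1 < qRoot q 2 :=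
  Real.one_lt_rpow hq (by norm_num)

theorem log_qRoot_two {q : ℝ} (hq : 1 < q) : Real.log (qRoot q 2) = Real.log q / 2 := by
  rw [qRoot, Real.log_rpow (zero_lt_one.trans hq)]
  push_cast
  ring

theorem tildeOrder_one (i : Fin 1) : tildeOrder ![1] i = 1 := by
  simp [tildeOrder]

theorem tildeOrder_one_two (i : Fin 2) : tildeOrder ![1, 2] i = 2 := by
  fin_cases i <;> norm_num [tildeOrder]

/-- The cross product jk is the source of the weight q^(-jk) in `borelConv`. -/
theorem triangle_add (j k : ℕ) :
    (j + k) * (j + k - 1) / 2 = j * (j - 1) / 2 + k * (k - 1) / 2 + j * k := by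
  induction k with
  | zero => simp
  | succ k ih =>
    have h1 := Nat.triangle_succ (j + k)
    have h2 := Nat.triangle_succ k
    rw [← add_assoc, h1, ih, h2]
    ring

theorem coeff_formalBorel {q : ℝ} (hq : 1 < q) {f : PowerSeries ℂ} {β : ℕ → ℂ}
    (hf : ∀ n, PowerSeries.coeff n f = β n * (q : ℂ) ^ (n * (n - 1) / 2)) (n : ℕ) :
    PowerSeries.coeff n (formalBorel q f) = β n := by
  have hq0 : (q : ℂ) ≠ 0 := by exact_mod_cast (zero_lt_one.trans hq).ne'
  rw [formalBorel, PowerSeries.coeff_mk, hf, mul_inv_cancel_right₀ (pow_ne_zero _ hq0)]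

theorem coeff_formalBorel_mul {q : ℝ} (hq : 1 < q) {f g : PowerSeries ℂ} {β γ : ℕ → ℂ}
    (hf : ∀ n, PowerSeries.coeff n f = β n * (q : ℂ) ^ (n * (n - 1) / 2))
    (hg : ∀ n, PowerSeries.coeff n g = γ n * (q : ℂ) ^ (n * (n - 1) / 2)) (n : ℕ) :
    PowerSeries.coeff n (formalBorel q (f * g)) = borelConv (Real.log q) β γ n := by
  have hq0 : (q : ℂ) ≠ 0 := by exact_mod_cast (zero_lt_one.trans hq).ne'
  rw [formalBorel, PowerSeries.coeff_mk, PowerSeries.coeff_mul, Finset.sum_mul, borelConv]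
  refine Finset.sum_congr rfl fun jk hjk => ?_
  obtain ⟨j, k⟩ := jk
  have hn : j + k = n := Finset.HasAntidiagonal.mem_antidiagonal.1 hjk
  have hexp : Complex.exp (-(j * k * Real.log q : ℝ)) = ((q : ℂ) ^ (j * k))⁻¹ := by
    rw [Complex.exp_neg]
    congr 1
    rw [← Complex.ofReal_exp, mul_comm, ← Nat.cast_mul, Real.exp_mul,
      Real.exp_log (zero_lt_one.trans hq), Real.rpow_natCast]
    push_cast
    rfl
  simp only [hf, hg, hexp]
  rw [← hn, triangle_add, pow_add, pow_add]
  field_simp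

theorem isConvergent_of_norm_coeff_le {f : PowerSeries ℂ} {M K : ℝ} (hK : 0 < K)
    (hf : ∀ n, ‖PowerSeries.coeff n f‖ ≤ M * K ^ n) : IsConvergent f := by
  refine ⟨1 / (2 * K), by positivity, ?_⟩
  refine Summable.of_nonneg_of_le (fun n => by positivity) (fun n => ?_)
    ((summable_geometric_of_lt_one (r := (1 / 2 : ℝ)) (by norm_num) (by norm_num)).mul_left M)
  refine (mul_le_mul_of_nonneg_right (hf n) (by positivity)).trans (le_of_eq ?_)
  rw [mul_assoc, ← mul_pow]
  congr 2
  field_simp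

theorem re_add_neg_of_modulus_lt {x : ℂ} {κ : ℝ} (hx : modulus x < Real.exp (-κ)) :
    x.re + κ < 0 := by
  have := Real.exp_lt_exp.1 hx
  linarith

/-- Differentiating a^(-n-1) m times produces (-1)^m (n+1)⋯(n+m), that is (-1)^m m! times a binomial
coefficient. -/
theorem coeff_eulerSeriesDeriv (q : ℝ) (m : ℕ) (a : ℂ) (n : ℕ) :
    PowerSeries.coeff n (eulerSeriesDeriv q m a) =
      (-1) ^ m * (m.factorial : ℂ) * invPowCoeff a m n * (q : ℂ) ^ (n * (n - 1) / 2) := by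
  have hz : (fun α : ℂ => PowerSeries.coeff n (eulerSeries q α)) =
      fun α => ((-1) ^ n * (q : ℂ) ^ (n * (n - 1) / 2)) * α ^ (-((n + 1 : ℕ) : ℤ)) := by
    funext α
    rw [eulerSeries, PowerSeries.coeff_mk, zpow_neg, zpow_natCast]
  have hprod : ∀ k : ℕ, ∏ i ∈ Finset.range k, (((-((n + 1 : ℕ) : ℤ) : ℤ) : ℂ) - i) =
      (-1) ^ k * ((n + 1).ascFactorial k : ℂ) := by
    intro k
    induction k with
    | zero => simp
    | succ k ih =>
      rw [Finset.prod_range_succ, ih, Nat.ascFactorial_succ]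
      push_cast
      ring
  have hpow : a ^ (-((n + 1 : ℕ) : ℤ) - (m : ℤ)) = (a ^ (n + m + 1))⁻¹ := by
    rw [← zpow_natCast, ← zpow_neg]
    congr 1
    push_cast
    ring
  rw [eulerSeriesDeriv, PowerSeries.coeff_mk, hz, iteratedDeriv_const_mul_field,
    iteratedDeriv_eq_iterate, iter_deriv_zpow, hprod, hpow, invPowCoeff,
    Nat.ascFactorial_eq_factorial_mul_choose]
  push_cast
  ring

/-! ### Towers of a single series and of a product -/

section Towers

variable {q d ε M κ : ℝ} {f g : PowerSeries ℂ} {β γ : ℕ → ℂ} {R Q : ℕ → ℂ → ℂ}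

theorem TaylorFamily.isTower (hR : TaylorFamily d ε M (Real.exp κ) β R) (hq : 1 < q) (hε : 0 < ε)
    (hf : ∀ n, PowerSeries.coeff n f = β n * (q : ℂ) ^ (n * (n - 1) / 2)) :
    IsTower q ![1] d f (fun _ => R 0) where
  borel_convergent := by
    simp only [Matrix.cons_val_zero, qRoot_one]
    exact isConvergent_of_norm_coeff_le (M := M) (Real.exp_pos κ) fun n => by
      rw [coeff_formalBorel hq hf]; exact hR.coeff n
  continuation_borel := by
    refine ⟨ε, hε, Real.exp (-κ), Real.exp_pos _, fun x hx hxR => ?_⟩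
    simp only [Matrix.cons_val_zero, qRoot_one, coeff_formalBorel hq hf, proj]
    simpa using (hR.hasSum hx (re_add_neg_of_modulus_lt hxR) 0).tsum_eq
  continuation_laplace := fun j => j.elim0
  mem_E := fun j => by
    rw [tildeOrder_one, qRoot_one]
    exact (hR.hol 0).memE hq hε

/-- The second function of the tower of a product. -/
noncomputable def laplaceCorr (L : ℝ) (f g : ℂ → ℂ) (x : ℂ) : ℂ :=
  ((Real.sqrt (2 * Real.pi * (L / 2)))⁻¹ : ℂ) * gaussCorr L f g (x - (L / 4 : ℝ))

theorem qLaplace_qRoot_two (hq : 1 < q) (φ : ℂ → ℂ) (x : ℂ) :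
    qLaplace (qRoot q 2) d φ x = ((Real.sqrt (2 * Real.pi * (Real.log q / 2)))⁻¹ : ℂ) *
      rayConv (Real.log q) d φ (x - (Real.log q / 4 : ℝ)) := by
  rw [qLaplace_eq_rayConv (one_lt_qRoot_two hq), log_qRoot_two hq,
    show 2 * (Real.log q / 2) = Real.log q by ring,
    show Real.log q / 2 / 2 = Real.log q / 4 by ring]

theorem TaylorFamily.laplaceCorr_hol (hR : TaylorFamily d ε M (Real.exp κ) β R)
    (hQ : TaylorFamily d ε M (Real.exp κ) γ Q) (hq : 1 < q) (hε : 0 < ε) :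
    ∃ B, BoundedHol d ε B (laplaceCorr (Real.log q) (R 0) (Q 0)) := by
  have hG := (hR.hol 0).gaussCorr (hQ.hol 0) (Real.log_pos hq) hε
  have h : BoundedHol d ε _ fun x => gaussCorr (Real.log q) (R 0) (Q 0)
      (x - (Real.log q / 4 : ℝ)) :=
    ⟨hG.diff.comp (by fun_prop) fun x hx => sub_ofReal_mem_sector hx _,
      fun x hx => hG.bound _ (sub_ofReal_mem_sector hx _)⟩
  exact ⟨_, h.const_mul _⟩

theorem TaylorFamily.isTower_mul (hR : TaylorFamily d ε M (Real.exp κ) β R)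
    (hQ : TaylorFamily d ε M (Real.exp κ) γ Q) (hq : 1 < q) (hε : 0 < ε)
    (hf : ∀ n, PowerSeries.coeff n f = β n * (q : ℂ) ^ (n * (n - 1) / 2))
    (hg : ∀ n, PowerSeries.coeff n g = γ n * (q : ℂ) ^ (n * (n - 1) / 2)) :
    IsTower q ![1, 2] d (f * g)
      ![gaussSeries (Real.log q) (crossTerm β γ R Q), laplaceCorr (Real.log q) (R 0) (Q 0)] where
  borel_convergent := by
    simp only [Matrix.cons_val_zero, qRoot_one]
    exact isConvergent_of_norm_coeff_le (M := M ^ 2) (K := 2 * Real.exp κ) (by positivity)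
      fun n => by
        rw [coeff_formalBorel_mul hq hf hg]
        exact hR.norm_borelConv_le hQ (Real.log_pos hq) n
  continuation_borel := by
    refine ⟨ε, hε, Real.exp (-κ), Real.exp_pos _, fun x hx hxR => ?_⟩
    have hre := re_add_neg_of_modulus_lt hxR
    simp only [Matrix.cons_val_zero, qRoot_one, coeff_formalBorel_mul hq hf hg, proj]
    rw [hR.tsum_borelConv hQ (Real.log_pos hq) hx hre,
      hR.mixedSeries_eq_gaussSeries hQ (Real.log_pos hq) hx hre]
  continuation_laplace := fun j => by
    refine ⟨ε, hε, Real.exp (-κ), Real.exp_pos _, fun x hx hxR => ?_⟩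
    have hL := Real.log_pos hq
    have hre := re_add_neg_of_modulus_lt hxR
    rw [tildeOrder_one_two, Fin.fin_one_eq_zero j, qLaplace_qRoot_two hq]
    simp only [Fin.castSucc_zero, Fin.succ_zero_eq_one, Matrix.cons_val_zero, Matrix.cons_val_one]
    -- The shift by L/4 lowers the real part, so the radius e^(-κ) still works.
    rw [laplaceCorr, hR.rayConv_gaussSeries_eq hQ hL hε (sub_ofReal_mem_sector hx _)]
    simp only [Complex.sub_re, Complex.ofReal_re]
    linarith
  mem_E := fun j => by
    rw [tildeOrder_one_two]
    obtain ⟨B, hB⟩ := hR.laplaceCorr_hol hQ hq hε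
    refine Fin.cases ?_ (fun i => ?_) j
    · exact memE_gaussSeries (Real.log_pos hq) (by rw [log_qRoot_two hq]; ring) hε
        (hR.crossTerm_hol hQ)
    · rw [Fin.fin_one_eq_zero i]
      exact hB.memE (one_lt_qRoot_two hq) hε

theorem rayConv_comp_sub (L d t : ℝ) (h : ℂ → ℂ) (y : ℂ) :
    rayConv L d (fun x => h (x - t)) y = rayConv L d h (y - t) := by
  rw [rayConv, ← integral_add_right_eq_self _ t]
  refine integral_congr_ae (Eventually.of_forall fun s => ?_)
  simp only [rayPoint]
  congr 2
  · push_cast; ring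
  · push_cast; ring

/-- The two order-two shifts L/4 add up to the order-one shift L/2, and the normalisations match
because 1/(πL) = 2 · 1/(2πL), the 2 being that of `rayConv_mul_rayConv`. -/
theorem TaylorFamily.qLaplace_laplaceCorr (hR : TaylorFamily d ε M (Real.exp κ) β R)
    (hQ : TaylorFamily d ε M (Real.exp κ) γ Q) (hq : 1 < q) (hε : 0 < ε) (x : ℂ) :
    qLaplace (qRoot q 2) d (laplaceCorr (Real.log q) (R 0) (Q 0)) x =
      qLaplace q d (R 0) x * qLaplace q d (Q 0) x := by
  have hL := Real.log_pos hq
  set L := Real.log q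
  have hconst : ∀ (c : ℂ) (h : ℂ → ℂ) (y : ℂ),
      rayConv L d (fun x => c * h x) y = c * rayConv L d h y := fun c h y => by
    simp only [rayConv, ← integral_const_mul]
    refine integral_congr_ae (Eventually.of_forall fun s => ?_)
    ring
  have hprod := rayConv_mul_rayConv (hR.hol 0) (hQ.hol 0) hL hε (x - (L / 2 : ℝ))
  have hs : x - ((L / 4 : ℝ) : ℂ) - ((L / 4 : ℝ) : ℂ) = x - ((L / 2 : ℝ) : ℂ) := by
    push_cast; ring
  have hsq : ∀ z : ℝ, 0 < z → ((Real.sqrt z)⁻¹ : ℂ) * ((Real.sqrt z)⁻¹ : ℂ) = (z : ℂ)⁻¹ :=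
    fun z hz => by
      rw [← mul_inv, ← Complex.ofReal_mul, Real.mul_self_sqrt hz.le]
  have hpi : (Real.pi : ℂ) ≠ 0 := by exact_mod_cast Real.pi_ne_zero
  have hLc : (L : ℂ) ≠ 0 := by exact_mod_cast hL.ne'
  rw [qLaplace_qRoot_two hq, qLaplace_eq_rayConv hq, qLaplace_eq_rayConv hq, mul_mul_mul_comm,
    hprod, hsq _ (by positivity)]
  change _ * rayConv L d (fun x => _ * gaussCorr L (R 0) (Q 0) (x - (L / 4 : ℝ))) _ = _
  rw [hconst, rayConv_comp_sub L d (L / 4) (gaussCorr L (R 0) (Q 0)), hs, ← mul_assoc,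
    hsq _ (by positivity)]
  push_cast
  field_simp

end Towers

/-! ### Application to the derivatives of the q-Euler series -/

theorem exists_taylorFamily_eulerSeriesDeriv (q : ℝ) {a : ℂ} (ha : a ≠ 0) (m : ℕ) {d : ℝ}
    (hd : ∀ k : ℤ, d ≠ Complex.arg (-a) + 2 * Real.pi * (k : ℝ)) :
    ∃ ε M K : ℝ, 0 < ε ∧ 1 ≤ K ∧ ∃ β R, TaylorFamily d ε M K β R ∧
      ∀ n, PowerSeries.coeff n (eulerSeriesDeriv q m a) = β n * (q : ℂ) ^ (n * (n - 1) / 2) := by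
  obtain ⟨ε, hε, δ, hδ, hdist⟩ := exists_dist_le_norm_add_exp ha hd
  obtain ⟨M, K, hK, R, hR⟩ := exists_taylorFamily_invPow ha hδ hdist m
  exact ⟨ε, _, K, hε, hK, _, _, hR.const_mul ((-1) ^ m * (m.factorial : ℂ)),
    fun n => coeff_eulerSeriesDeriv q m a n⟩

end QSummation

theorem corollary1 (q : ℝ) (hq : 1 < q) (a b : ℂ) (ha : a ≠ 0) (hb : b ≠ 0)
    (m n : ℕ) (hm : 1 ≤ m) (hn : 1 ≤ n) (d : ℝ)
    (hda : ∀ k : ℤ, d ≠ Complex.arg (-a) + 2 * Real.pi * (k : ℝ))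
    (hdb : ∀ k : ℤ, d ≠ Complex.arg (-b) + 2 * Real.pi * (k : ℝ)) :
    QSummation.QMultisummable q ![1] d (QSummation.eulerSeriesDeriv q m a) ∧
    QSummation.QMultisummable q ![1] d (QSummation.eulerSeriesDeriv q n b) ∧
    QSummation.QMultisummable q ![1, 2] d
      (QSummation.eulerSeriesDeriv q m a * QSummation.eulerSeriesDeriv q n b) ∧
    ∀ x : QSummation.LogSurface,
      QSummation.QSumConvergesAt q ![1] d (QSummation.eulerSeriesDeriv q m a) x ∧
      QSummation.QSumConvergesAt q ![1] d (QSummation.eulerSeriesDeriv q n b) x ∧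
      QSummation.QSumConvergesAt q ![1, 2] d
        (QSummation.eulerSeriesDeriv q m a * QSummation.eulerSeriesDeriv q n b) x ∧
      QSummation.qSum q ![1, 2] d
          (QSummation.eulerSeriesDeriv q m a * QSummation.eulerSeriesDeriv q n b) x =
        QSummation.qSum q ![1] d (QSummation.eulerSeriesDeriv q m a) x *
          QSummation.qSum q ![1] d (QSummation.eulerSeriesDeriv q n b) x := by
  open QSummation in
  obtain ⟨ε₁, M₁, K₁, hε₁, hK₁, β, R, hR, hf⟩ :=
    exists_taylorFamily_eulerSeriesDeriv q ha m hda
  obtain ⟨ε₂, M₂, K₂, hε₂, hK₂, γ, Q, hQ, hg⟩ :=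
    exists_taylorFamily_eulerSeriesDeriv q hb n hdb
  have hε : 0 < min ε₁ ε₂ := lt_min hε₁ hε₂
  -- Both factors are put on a common sector with common constants, the ratio being written e^κ as
  -- the product lemmas expect.
  have hexp : Real.exp (Real.log (max K₁ K₂)) = max K₁ K₂ :=
    Real.exp_log (zero_lt_one.trans_le (hK₁.trans (le_max_left _ _)))
  have hR' : TaylorFamily d (min ε₁ ε₂) (max M₁ M₂) (Real.exp (Real.log (max K₁ K₂))) β R :=
    hR.mono (min_le_left _ _) (le_max_left _ _) (zero_le_one.trans hK₁)
      (hexp.symm ▸ le_max_left _ _)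
  have hQ' : TaylorFamily d (min ε₁ ε₂) (max M₁ M₂) (Real.exp (Real.log (max K₁ K₂))) γ Q :=
    hQ.mono (min_le_right _ _) (le_max_right _ _) (zero_le_one.trans hK₂)
      (hexp.symm ▸ le_max_right _ _)
  have t₁ := hR'.isTower hq hε hf
  have t₂ := hQ'.isTower hq hε hg
  have t₃ := hR'.isTower_mul hQ' hq hε hf hg
  have p₁ : (∀ i, 0 < (![1] : Fin 1 → ℚ) i) ∧ StrictMono (![1] : Fin 1 → ℚ) :=
    ⟨by simp, Subsingleton.strictMono _⟩
  have p₂ : (∀ i, 0 < (![1, 2] : Fin 2 → ℚ) i) ∧ StrictMono (![1, 2] : Fin 2 → ℚ) := by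
    refine ⟨fun i => by fin_cases i <;> simp, Fin.strictMono_iff_lt_succ.2 fun i => ?_⟩
    rw [Fin.fin_one_eq_zero i]
    norm_num
  refine ⟨⟨p₁.1, p₁.2, _, t₁⟩, ⟨p₁.1, p₁.2, _, t₂⟩, ⟨p₂.1, p₂.2, _, t₃⟩, fun x =>
    ⟨⟨_, t₁, ?_⟩, ⟨_, t₂, ?_⟩, ⟨_, t₃, ?_⟩, ?_⟩⟩
  · rw [tildeOrder_one, qRoot_one]
    exact (hR'.hol 0).integrable_laplaceIntegrand hq hε x
  · rw [tildeOrder_one, qRoot_one]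
    exact (hQ'.hol 0).integrable_laplaceIntegrand hq hε x
  · rw [tildeOrder_one_two]
    obtain ⟨B, hB⟩ := hR'.laplaceCorr_hol hQ' hq hε
    exact hB.integrable_laplaceIntegrand (one_lt_qRoot_two hq) hε x
  · rw [t₁.qSum_eq, t₂.qSum_eq, t₃.qSum_eq, tildeOrder_one, tildeOrder_one_two, qRoot_one]
    exact hR'.qLaplace_laplaceCorr hQ' hq hε x
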